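/- **Notation.** Let $n\ge 2$ be an integer, let $J_n$ be the $n\times n$ matrix with $(J_n)_{i,i+1}=1$ and all other entries $0$, and let $e_n=(0,\dots,0,1)^T$. Put $s(x)=x/\max(1,|x|)$ and $\lfloor x\rceil^a=|x|^a\operatorname{sign}(x)$ for $x\in\mathbb R$. *$S$-functions.* An $S$-function is a locally Lipschitz $\sigma:\mathbb R\to\mathbb R$ for which there are positive constants $a_1\le a_2$, $b_1,b_2$ with $\frac{a_1}{b_1}\le\frac{a_2}{b_2}$ such that $a_1x\,s(x/b_1)\le x\sigma(x)\le a_2x\,s(x/b_2)$ for all $x$, such that $\sigma_{+\infty}=\lim_{+\infty}\sigma$ and $\sigma_{-\infty}=\lim_{-\infty}\sigma$ exist with $\sigma_{-\infty}=-\sigma_{+\infty}$, and such that $|\sigma(|x|)-\sigma_{+\infty}|\le \frac{C_\sigma}{1+|x|}$ for all $x$ and some $C_\sigma>0$. *Homogeneous feedback.* Let $p_i=1-\frac{i-1}{n}$ for $1\le i\le n+1$ and $\beta_i=\frac{n-1+i}{n-i}$ for $0\le i\le n-1$ (so $\beta_0=p_2$). Given $l_1,\dots,l_n>0$, put $v_0=0$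 and, for $1\le i\le n$, $\omega_i=\lfloor x_i\rceil^{\beta_{i-1}}-\lfloor v_{i-1}\rceil^{\beta_{i-1}}$ and $v_i=-l_i\lfloor\omega_i\rceil^{p_{i+1}/(p_i\beta_{i-1})}$. Let $$V_n=\sum_{i=1}^nW_i,\qquad W_i=\int_{v_{i-1}}^{x_i}\big(\lfloor s\rceil^{\beta_{i-1}}-\lfloor v_{i-1}\rceil^{\beta_{i-1}}\big)\,ds,\qquad \alpha=\frac{2(n-1)}{2n-1}.$$ Call $l=(l_1,\dots,l_n)$ admissible if all $l_i>0$ and for some $c>0$, for all $x\in\mathbb R^n$ and $u\in\mathbb R$, $$\nabla V_n(x)\cdot(J_nx+e_nu)\le -c\,V_n(x)^\alpha+\omega_n(x)\big(u+l_n\operatorname{sign}\omega_n(x)\big).$$ *Linear feedback.* Given $l$ and an $S$-function $\sigma$ with constants $a_i,b_i$, consider pairs $(K,P)$ with $K\in\mathbb R^n$ and $P$ a real symmetric positive definite matrix such that, for all $\rho\in[\frac{a_1}{b_1},\frac{a_2}{b_2}]$, $$\Big(J_n-\tfrac{\rho l_n}{\sigma_{+\infty}}e_nK^T\Big)^TP+P\Big(J_n-\tfrac{\rho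 l_n}{\sigma_{+\infty}}e_nK^T\Big)\le-\mathrm{Id}_n. \tag{1}$$ Put $V_0(x)=(x^TPx)^{1/2}$ and, for $A,k>0$, let $\omega(x)=\omega_n(x)$ if $V_0(x)>A$ and $\omega(x)=K^Tx/k$ if $V_0(x)\le A$. *Finite-gain stability.* Let $g:\mathbb R\to\mathbb R$, $f:\mathbb R^n\to\mathbb R$ and $p\in[1,\infty]$. Trajectories of $\dot x=J_nx+e_ng(f(x)+d)$ on $[0,T)$, $0<T\le\infty$, are locally absolutely continuous curves satisfying the equation for almost every $t$. The system $\dot x=J_nx+e_ng(u)$ is finite-gain $L_p$-stabilized by $u=f(x)$ if there is $\gamma_p>0$ such that for all $d\in L_p(\mathbb R_+)$: every trajectory on an interval $[0,T)$ with $x(0)=0$ satisfies $\|x\|_{L_p(0,T)}\le\gamma_p\|d\|_p$; and, if $p=\infty$, every trajectory on $[0,\infty)$, with any initial point, also satisfies $\limsup_{t\to\infty}\|x(t)\|\le\gamma_\infty\|d\|_\infty$. **Theorem.** Let $n\ge2$. Admissible gains exist. Let $l$ be admissible and let $\sigma$ be an $S$-function with constants $a_1,a_2,b_1,b_2$. Then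 pairs $(K,P)$ satisfying (1) exist; and for every such pair and every $A>0$ with $$\max_{V_0(x)\le A}|K^Tx|\le\min(1,b_1,b_2),$$ there is $k_0>0$ such that for every $k\ge k_0$ and every $p\in[1,\infty]$: 1. the system $\dot x=J_nx-\frac{l_n}{\sigma_{+\infty}}e_n\sigma(u)$ is finite-gain $L_p$-stabilized by $u=k\,\omega(x)$; 2. likewise, after a linear rescaling of the state and a change of sign of the feedback, the saturated integrator $\dot x=J_nx+e_n\sigma(u)$ is finite-gain $L_p$-stabilized by $u=-k\,\omega\big(\frac{l_n}{\sigma_{+\infty}}x\big)$. In particular the $L_p$-norm of each coordinate $x_i$ of a trajectory starting at the origin is at most a constant times $\|d\|_p$. -/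

import Mathlib

open MeasureTheory Filter Set
open scoped ENNReal Topology

noncomputable section

namespace IntegratorChain

/-- The standard saturation `s(x) = x / max(1, |x|)`. -/
def stdSat (x : ℝ) : ℝ := x / max 1 |x|

/-- `σ` is an `S`-function with sector constants `a₁, a₂, b₁, b₂` and limit `σinf` at `+∞`
(and `-σinf` at `-∞`). -/
structure IsSFunction (σ : ℝ → ℝ) (a₁ a₂ b₁ b₂ σinf : ℝ) : Prop where
  locallyLipschitz : LocallyLipschitz σ
  a₁_pos : 0 < a₁
  b₁_pos : 0 < b₁
  b₂_pos : 0 < b₂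
  a_le : a₁ ≤ a₂
  ratio_le : a₁ / b₁ ≤ a₂ / b₂
  sector_lower : ∀ x, a₁ * x * stdSat (x / b₁) ≤ x * σ x
  sector_upper : ∀ x, x * σ x ≤ a₂ * x * stdSat (x / b₂)
  tendsto_atTop : Tendsto σ atTop (𝓝 σinf)
  tendsto_atBot : Tendsto σ atBot (𝓝 (-σinf))
  rate : ∃ C > 0, ∀ x : ℝ, |(σ |x|) - σinf| ≤ C / (1 + |x|)

/-- The Jordan block `J_n`: ones on the superdiagonal, zeros elsewhere. -/
def jordanBlock (n : ℕ) : Matrix (Fin n) (Fin n) ℝ :=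
  Matrix.of fun i j => if i.val + 1 = j.val then 1 else 0

/-- The last vector `e_n` of the canonical basis. -/
def lastVec (n : ℕ) : Fin n → ℝ := fun i => if i.val + 1 = n then 1 else 0

/-! ### Trajectories and finite-gain stability -/

/-- The time interval `[0, T)`, with `T = ∞` allowed. -/
def timeInterval (T : ℝ≥0∞) : Set ℝ := {t | 0 ≤ t ∧ ENNReal.ofReal t < T}

/-- `x` is a trajectory on `[0, T)` of `ẋ = J_n x + e_n σ(f(x) + d)`: locally absolutely
continuous, and the equation holds at almost every time. The feedback `f` may be
discontinuous; the equation uses its actual values. -/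
def IsTrajectory (n : ℕ) (σ : ℝ → ℝ) (f : (Fin n → ℝ) → ℝ) (d : ℝ → ℝ) (T : ℝ≥0∞)
    (x : ℝ → Fin n → ℝ) : Prop :=
  (∀ t ∈ timeInterval T, AbsolutelyContinuousOnInterval x 0 t) ∧
  ∀ᵐ t ∂(volume.restrict (timeInterval T)),
    HasDerivAt x ((jordanBlock n).mulVec (x t) + σ (f (x t) + d t) • lastVec n) t

/-- The system `ẋ = J_n x + e_n σ(u)` is finite-gain `L_p`-stable under `u = f(x)`, with respect
to disturbances `u = f(x) + d`. The norm of the state is the Euclidean one.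
* Trajectories from the origin satisfy `‖x‖_p ≤ γ ‖d‖_p` (on their interval of definition).
* If `p = ∞`, moreover, trajectories on `[0, ∞)` from any initial point satisfy
  `limsup ‖x(t)‖ ≤ γ ‖d‖_∞`. -/
def IsFiniteGainLpStabilizing (n : ℕ) (σ : ℝ → ℝ) (f : (Fin n → ℝ) → ℝ) (p : ℝ≥0∞) : Prop :=
  ∃ γ : ℝ, 0 < γ ∧ ∀ d : ℝ → ℝ, MemLp d p (volume.restrict (Ici 0)) →
    (∀ (T : ℝ≥0∞) (x : ℝ → Fin n → ℝ), IsTrajectory n σ f d T x → x 0 = 0 →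
      eLpNorm (fun t => WithLp.toLp 2 (x t)) p (volume.restrict (timeInterval T)) ≤
        ENNReal.ofReal γ * eLpNorm d p (volume.restrict (Ici 0))) ∧
    (p = ∞ → ∀ x : ℝ → Fin n → ℝ, IsTrajectory n σ f d ∞ x →
      limsup (fun t => ‖WithLp.toLp 2 (x t)‖ₑ) atTop ≤
        ENNReal.ofReal γ * eLpNorm d ∞ (volume.restrict (Ici 0)))

/-! ### The homogeneous feedback and its Lyapunov function -/

/-- The signed power `⌊x⌉^a = |x|^a sign(x)`. -/
def spow (x a : ℝ) : ℝ := |x| ^ a * Real.sign x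

/-- The weights `p_i = 1 - (i - 1) / n`. -/
def wt (n i : ℕ) : ℝ := 1 - ((i : ℝ) - 1) / n

/-- The exponents `β_i = (n - 1 + i) / (n - i)`, `0 ≤ i ≤ n - 1`; in particular `β_0 = p_2`. -/
def beta (n i : ℕ) : ℝ := ((n : ℝ) - 1 + i) / (n - i)

/-- The `i`-th coordinate of `x`, with `i` counted from `1` to `n` (and `0` for other `i`). -/
def coord {n : ℕ} (x : Fin n → ℝ) (i : ℕ) : ℝ :=
  if h : 1 ≤ i ∧ i ≤ n then x ⟨i - 1, by omega⟩ else 0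

/-- The functions `v_i`, for gains `l 1, …, l n`: `v_0 = 0` and
`v_i = -l_i ⌊ω_i⌉^(p_{i+1} / (p_i β_{i-1}))` with
`ω_i = ⌊x_i⌉^β_{i-1} - ⌊v_{i-1}⌉^β_{i-1}`. -/
def vFun {n : ℕ} (l : ℕ → ℝ) (x : Fin n → ℝ) : ℕ → ℝ
  | 0 => 0
  | i + 1 =>
    -l (i + 1) * spow (spow (coord x (i + 1)) (beta n i) - spow (vFun l x i) (beta n i))
      (wt n (i + 2) / (wt n (i + 1) * beta n i))

/-- The functions `ω_i = ⌊x_i⌉^β_{i-1} - ⌊v_{i-1}⌉^β_{i-1}`, for `1 ≤ i ≤ n`. -/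
def omegaFun {n : ℕ} (l : ℕ → ℝ) (x : Fin n → ℝ) (i : ℕ) : ℝ :=
  spow (coord x i) (beta n (i - 1)) - spow (vFun l x (i - 1)) (beta n (i - 1))

theorem vFun_succ {n : ℕ} (l : ℕ → ℝ) (x : Fin n → ℝ) (i : ℕ) :
    vFun l x (i + 1) =
      -l (i + 1) * spow (omegaFun l x (i + 1)) (wt n (i + 2) / (wt n (i + 1) * beta n i)) :=
  rfl

/-- `W_i`, the integral of `⌊s⌉^β_{i-1} - ⌊v_{i-1}⌉^β_{i-1}` over `s` from `v_{i-1}` to `x_i`. -/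
def wFun {n : ℕ} (l : ℕ → ℝ) (x : Fin n → ℝ) (i : ℕ) : ℝ :=
  (|coord x i| ^ (beta n (i - 1) + 1) - |vFun l x (i - 1)| ^ (beta n (i - 1) + 1)) /
      (beta n (i - 1) + 1) -
    spow (vFun l x (i - 1)) (beta n (i - 1)) * (coord x i - vFun l x (i - 1))

/-- The Lyapunov function `V_n = W_1 + ⋯ + W_n`. -/
def lyap {n : ℕ} (l : ℕ → ℝ) (x : Fin n → ℝ) : ℝ := ∑ i ∈ Finset.Icc 1 n, wFun l x i

/-- The gains `l_1, …, l_n` are positive and such that, for some `c > 0`, the derivative of `V_n`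
along `ẋ = J_n x + e_n u` is at most `-c V_n^α + ω_n (u + l_n sign ω_n)`, where
`α = 2(n-1)/(2n-1)`. -/
def AdmissibleGains (n : ℕ) (l : ℕ → ℝ) : Prop :=
  (∀ i, 1 ≤ i → i ≤ n → 0 < l i) ∧
  ∃ c > 0, ∀ (x : Fin n → ℝ) (u : ℝ),
    fderiv ℝ (lyap l) x ((jordanBlock n).mulVec x + u • lastVec n) ≤
      -c * lyap l x ^ (2 * ((n : ℝ) - 1) / (2 * n - 1)) +
        omegaFun l x n * (u + l n * Real.sign (omegaFun l x n))

/-! ### The linear feedback near the origin and the switched feedback -/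

/-- `P` is symmetric positive definite and, for every `ρ ∈ [ρ₁, ρ₂]`, the closed-loop matrix
`M = J_n - ρ g e_n Kᵀ` satisfies `Mᵀ P + P M ≤ -Id`. -/
def RobustLyapunovPair (n : ℕ) (g ρ₁ ρ₂ : ℝ) (K : Fin n → ℝ) (P : Matrix (Fin n) (Fin n) ℝ) :
    Prop :=
  P.PosDef ∧ ∀ ρ ∈ Icc ρ₁ ρ₂,
    (-(1 : Matrix (Fin n) (Fin n) ℝ) -
      ((jordanBlock n - (ρ * g) • Matrix.vecMulVec (lastVec n) K).transpose * P +
        P * (jordanBlock n - (ρ * g) • Matrix.vecMulVec (lastVec n) K))).PosSemidef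

/-- `V_0(x) = (xᵀ P x)^(1/2)`. -/
def quadNorm {n : ℕ} (P : Matrix (Fin n) (Fin n) ℝ) (x : Fin n → ℝ) : ℝ :=
  Real.sqrt (x ⬝ᵥ P.mulVec x)

/-- The feedback `ω`: equal to `ω_n(x)` where `V_0(x) > A` and to `Kᵀ x / k` where
`V_0(x) ≤ A`. -/
def switchedFeedback {n : ℕ} (l : ℕ → ℝ) (K : Fin n → ℝ) (P : Matrix (Fin n) (Fin n) ℝ)
    (A k : ℝ) (x : Fin n → ℝ) : ℝ :=
  open Classical in if A < quadNorm P x then omegaFun l x n else (K ⬝ᵥ x) / k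

end IntegratorChain

end

namespace IntegratorChain

/-! ### Signed powers -/

@[simp] theorem spow_zero_left (a : ℝ) : spow 0 a = 0 := by simp [spow]

theorem spow_of_pos {x : ℝ} (hx : 0 < x) (a : ℝ) : spow x a = x ^ a := by
  simp [spow, Real.sign_of_pos hx, abs_of_pos hx]

theorem spow_neg (x a : ℝ) : spow (-x) a = -spow x a := by
  simp [spow, Real.sign_neg]

theorem spow_of_neg {x : ℝ} (hx : x < 0) (a : ℝ) : spow x a = -(-x) ^ a := by
  rw [← spow_of_pos (neg_pos.2 hx), spow_neg, neg_neg]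

theorem spow_one (x : ℝ) : spow x 1 = x := by
  rcases lt_trichotomy x 0 with h | rfl | h
  · simp [spow_of_neg h]
  · simp
  · simp [spow_of_pos h]

theorem sign_mul_eq (x y : ℝ) : Real.sign (x * y) = Real.sign x * Real.sign y := by
  rcases lt_trichotomy x 0 with h | rfl | h <;> rcases lt_trichotomy y 0 with h' | rfl | h' <;>
    simp [Real.sign_of_neg, Real.sign_of_pos, mul_pos_of_neg_of_neg, mul_neg_of_neg_of_pos,
      mul_neg_of_pos_of_neg, *]

theorem spow_mul_left (x y a : ℝ) : spow (x * y) a = spow x a * spow y a := by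
  simp only [spow, abs_mul, sign_mul_eq, Real.mul_rpow (abs_nonneg x) (abs_nonneg y)]
  ring

theorem spow_spow (x a b : ℝ) : spow (spow x a) b = spow x (a * b) := by
  rcases lt_trichotomy x 0 with h | rfl | h
  · have h' : 0 < -x := neg_pos.2 h
    rw [spow_of_neg h, spow_of_neg h, spow_neg, spow_of_pos (Real.rpow_pos_of_pos h' _),
      Real.rpow_mul h'.le]
  · simp
  · rw [spow_of_pos h, spow_of_pos h, spow_of_pos (Real.rpow_pos_of_pos h _), Real.rpow_mul h.le]

theorem abs_spow (x : ℝ) {a : ℝ} (ha : a ≠ 0) : |spow x a| = |x| ^ a := by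
  rcases lt_trichotomy x 0 with h | rfl | h
  · have h' : 0 < -x := neg_pos.2 h
    rw [spow_of_neg h, abs_neg, abs_of_neg h, abs_of_pos (Real.rpow_pos_of_pos h' _)]
  · simp [Real.zero_rpow ha]
  · rw [spow_of_pos h, abs_of_pos h, abs_of_pos (Real.rpow_pos_of_pos h _)]

theorem spow_injective {a : ℝ} (ha : a ≠ 0) : Function.Injective fun x => spow x a := by
  intro x y h
  have := congrArg (fun z => spow z a⁻¹) h
  simpa [spow_spow, mul_inv_cancel₀ ha, spow_one] using this

theorem mul_spow (x : ℝ) {a : ℝ} (ha : 0 ≤ a) : x * spow x a = |x| ^ (a + 1) := by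
  rcases lt_trichotomy x 0 with h | rfl | h
  · have h' : 0 < -x := neg_pos.2 h
    rw [spow_of_neg h, abs_of_neg h, Real.rpow_add_one h'.ne']
    ring
  · simp [Real.zero_rpow (by linarith : a + 1 ≠ 0)]
  · rw [spow_of_pos h, abs_of_pos h, Real.rpow_add_one h.ne']
    ring

theorem spow_eq_max (x : ℝ) {a : ℝ} (ha : a ≠ 0) :
    spow x a = max x 0 ^ a - max (-x) 0 ^ a := by
  rcases lt_trichotomy x 0 with h | rfl | h
  · rw [spow_of_neg h, max_eq_right h.le, max_eq_left (by linarith), Real.zero_rpow ha, zero_sub]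
  · simp
  · rw [spow_of_pos h, max_eq_left h.le, max_eq_right (by linarith), Real.zero_rpow ha, sub_zero]

theorem continuous_spow {a : ℝ} (ha : 0 < a) : Continuous fun x => spow x a := by
  simp only [spow_eq_max _ ha.ne']
  refine Continuous.sub ?_ ?_ <;>
  exact Continuous.rpow_const (by fun_prop) fun _ => Or.inr ha.le

theorem hasDerivAt_spow {a : ℝ} (ha : 1 < a) (x : ℝ) :
    HasDerivAt (fun x => spow x a) (a * |x| ^ (a - 1)) x := by
  refine hasDerivAt_of_hasDerivAt_of_ne' (x := 0) (g := fun x => a * |x| ^ (a - 1))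
    (fun y hy => ?_) (continuous_spow (by linarith)).continuousAt ?_ x
  · rcases lt_or_gt_of_ne hy with h | h
    · have h1 := ((hasDerivAt_neg y).rpow_const (p := a) (Or.inr ha.le)).neg
      refine (h1.congr_of_eventuallyEq ?_).congr_deriv ?_
      · filter_upwards [gt_mem_nhds h] with z hz using spow_of_neg hz a
      · rw [abs_of_neg h]; ring
    · have h1 := (hasDerivAt_id y).rpow_const (p := a) (Or.inr ha.le)
      refine (h1.congr_of_eventuallyEq ?_).congr_deriv ?_
      · filter_upwards [lt_mem_nhds h] with z hz using spow_of_pos hz a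
      · rw [abs_of_pos h]; simp
  · exact (continuous_const.mul
      (continuous_abs.rpow_const fun _ => Or.inr (by linarith))).continuousAt

theorem contDiff_spow {a : ℝ} (ha : 1 < a) : ContDiff ℝ 1 fun x => spow x a := by
  rw [contDiff_one_iff_deriv]
  refine ⟨fun x => (hasDerivAt_spow ha x).differentiableAt, ?_⟩
  rw [show deriv (fun x => spow x a) = fun x => a * |x| ^ (a - 1) from
    funext fun x => (hasDerivAt_spow ha x).deriv]
  exact continuous_const.mul (continuous_abs.rpow_const fun _ => Or.inr (by linarith))

theorem hasDerivAt_abs_rpow_eq_spow {a : ℝ} (ha : 0 < a) (x : ℝ) :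
    HasDerivAt (fun x => |x| ^ (a + 1)) ((a + 1) * spow x a) x := by
  refine (hasDerivAt_abs_rpow x (by linarith : 1 < a + 1)).congr_deriv ?_
  rw [mul_assoc]
  congr 1
  rcases lt_trichotomy x 0 with h | rfl | h
  · rw [spow_of_neg h, abs_of_neg h, show a = (a + 1 - 2) + 1 by ring,
      Real.rpow_add_one (neg_pos.2 h).ne']
    ring_nf
  · simp
  · rw [spow_of_pos h, abs_of_pos h]
    conv_rhs => rw [show a = (a + 1 - 2) + 1 by ring, Real.rpow_add_one h.ne']

theorem contDiff_abs_rpow {a : ℝ} (ha : 1 < a) : ContDiff ℝ 1 fun x : ℝ => |x| ^ a := by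
  simpa using contDiff_norm_rpow (E := ℝ) ha

/-! ### Weights and exponents -/

section Exponents

variable {n i : ℕ}

theorem beta_pos (hn : 2 ≤ n) (hi : i < n) : 0 < beta n i := by
  have h1 : (2 : ℝ) ≤ n := by exact_mod_cast hn
  have h2 : (i : ℝ) < n := by exact_mod_cast hi
  have h3 : (0 : ℝ) ≤ i := i.cast_nonneg
  exact div_pos (by linarith) (by linarith)

theorem one_lt_beta (hn : 2 ≤ n) (h1 : 1 ≤ i) (hi : i < n) : 1 < beta n i := by
  have h0 : (2 : ℝ) ≤ n := by exact_mod_cast hn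
  have h2 : (i : ℝ) < n := by exact_mod_cast hi
  have h3 : (1 : ℝ) ≤ i := by exact_mod_cast h1
  rw [beta, one_lt_div (by linarith)]
  linarith

theorem wt_succ (hn : 2 ≤ n) : wt n (i + 1) = ((n : ℝ) - i) / n := by
  have h0 : (n : ℝ) ≠ 0 := by exact_mod_cast (by omega : n ≠ 0)
  rw [wt]
  push_cast
  field_simp
  ring

theorem wt_succ_pos (hn : 2 ≤ n) (hi : i < n) : 0 < wt n (i + 1) := by
  have h2 : (i : ℝ) < n := by exact_mod_cast hi
  have h3 : (0 : ℝ) ≤ i := i.cast_nonneg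
  rw [wt_succ hn]
  exact div_pos (by linarith) (by linarith)

theorem wt_succ_le_one (hn : 2 ≤ n) : wt n (i + 1) ≤ 1 := by
  have h3 : (0 : ℝ) ≤ i := i.cast_nonneg
  have h0 : (0 : ℝ) < n := by exact_mod_cast (by omega : 0 < n)
  rw [wt_succ hn, div_le_one h0]
  linarith

theorem wt_mul_beta (hn : 2 ≤ n) (hi : i < n) :
    wt n (i + 1) * beta n i = ((n : ℝ) - 1 + i) / n := by
  have h2 : (i : ℝ) < n := by exact_mod_cast hi
  have h3 : (n : ℝ) - i ≠ 0 := by linarith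
  rw [wt_succ hn, beta]
  field_simp

/-- The homogeneity degree of `ω_{i+1}` is positive. -/
theorem wt_mul_beta_pos (hn : 2 ≤ n) (hi : i < n) : 0 < wt n (i + 1) * beta n i :=
  mul_pos (wt_succ_pos hn hi) (beta_pos hn hi)

theorem wt_mul_beta_add_one (hn : 2 ≤ n) (hi : i < n) :
    wt n (i + 1) * (beta n i + 1) = (2 * (n : ℝ) - 1) / n := by
  rw [mul_add, wt_mul_beta hn hi, wt_succ hn]
  ring

theorem exponent_mul_beta (hn : 2 ≤ n) (hi : i + 1 < n) :
    wt n (i + 2) / (wt n (i + 1) * beta n i) * beta n (i + 1) = ((n : ℝ) + i) / (n - 1 + i) := by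
  have h0 : (2 : ℝ) ≤ n := by exact_mod_cast hn
  have h3 : (0 : ℝ) ≤ i := i.cast_nonneg
  have h2 : (n : ℝ) - 1 + i ≠ 0 := by linarith
  have h4 := wt_mul_beta hn hi
  rw [div_mul_eq_mul_div, h4, wt_mul_beta hn (by omega)]
  push_cast
  field_simp
  ring

theorem one_lt_exponent_mul_beta (hn : 2 ≤ n) (hi : i + 1 < n) :
    1 < wt n (i + 2) / (wt n (i + 1) * beta n i) * beta n (i + 1) := by
  have h0 : (2 : ℝ) ≤ n := by exact_mod_cast hn
  have h3 : (0 : ℝ) ≤ i := i.cast_nonneg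
  rw [exponent_mul_beta hn hi, one_lt_div (by linarith)]
  linarith

end Exponents

/-! ### Coordinates -/

section Coord

variable {n : ℕ}

theorem coord_succ (x : Fin n → ℝ) (j : Fin n) : coord x (j + 1) = x j := by
  simp [coord]

theorem coord_of_gt (x : Fin n → ℝ) {i : ℕ} (hi : n < i) : coord x i = 0 := by
  simp [coord, hi]

@[simp] theorem coord_zero_right (x : Fin n → ℝ) : coord x 0 = 0 := by simp [coord]

@[simp] theorem coord_zero_left (i : ℕ) : coord (0 : Fin n → ℝ) i = 0 := by simp [coord]

theorem coord_add (x y : Fin n → ℝ) (i : ℕ) : coord (x + y) i = coord x i + coord y i := by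
  unfold coord; split_ifs <;> simp

theorem coord_smul (c : ℝ) (x : Fin n → ℝ) (i : ℕ) : coord (c • x) i = c * coord x i := by
  unfold coord; split_ifs <;> simp

theorem contDiff_coord (i : ℕ) : ContDiff ℝ 1 fun x : Fin n → ℝ => coord x i := by
  unfold coord; split_ifs
  · exact contDiff_apply ℝ ℝ _
  · exact contDiff_const

/-- The `i`-th vector of the canonical basis, with `i` counted from `1`. -/
noncomputable def unitVec (n i : ℕ) : Fin n → ℝ := fun j => if j.val + 1 = i then 1 else 0

theorem coord_unitVec (i j : ℕ) (hi : 1 ≤ i) (hin : i ≤ n) :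
    coord (unitVec n i) j = if j = i then 1 else 0 := by
  unfold coord unitVec
  simp only
  split_ifs <;> first | rfl | omega

theorem jordanBlock_mulVec_apply (x : Fin n → ℝ) (j : Fin n) :
    (jordanBlock n).mulVec x j = coord x (j + 2) := by
  simp only [Matrix.mulVec, dotProduct, jordanBlock, Matrix.of_apply, ite_mul, one_mul, zero_mul]
  by_cases h : j.val + 1 < n
  · rw [Finset.sum_eq_single ⟨j.val + 1, h⟩]
    · have := coord_succ x ⟨j.val + 1, h⟩
      simp only at this ⊢
      rw [← this]
      simp
    · intro b _ hb
      rw [if_neg]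
      rintro h'
      exact hb (Fin.ext h'.symm)
    · simp
  · rw [coord_of_gt x (by omega)]
    refine Finset.sum_eq_zero fun b _ => if_neg ?_
    have := b.isLt
    omega

theorem jordanBlock_mulVec_unitVec (i : ℕ) (hi : i + 1 ≤ n) :
    (jordanBlock n).mulVec (unitVec n (i + 1)) = unitVec n i := by
  ext j
  rw [jordanBlock_mulVec_apply, coord_unitVec _ _ (by omega) hi]
  simp [unitVec]

end Coord

/-! ### Structure of the homogeneous feedback -/

section Structure

variable {n : ℕ}

/-- The signed power `⌊v_i⌉^β_i`. -/
noncomputable def zFun (l : ℕ → ℝ) (x : Fin n → ℝ) (i : ℕ) : ℝ := spow (vFun l x i) (beta n i)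

theorem omegaFun_succ (l : ℕ → ℝ) (x : Fin n → ℝ) (i : ℕ) :
    omegaFun l x (i + 1) = spow (coord x (i + 1)) (beta n i) - zFun l x i := rfl

theorem zFun_zero (l : ℕ → ℝ) (x : Fin n → ℝ) : zFun l x 0 = 0 := by
  simp [zFun, vFun]

theorem zFun_succ (l : ℕ → ℝ) (x : Fin n → ℝ) (i : ℕ) :
    zFun l x (i + 1) = spow (-l (i + 1)) (beta n (i + 1)) * spow (omegaFun l x (i + 1))
      (wt n (i + 2) / (wt n (i + 1) * beta n i) * beta n (i + 1)) := by
  rw [zFun, vFun_succ, spow_mul_left, spow_spow]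

theorem vFun_congr {l l' : ℕ → ℝ} {x y : Fin n → ℝ} (i : ℕ) (hl : ∀ j ≤ i, l j = l' j)
    (hx : ∀ j ≤ i, coord x j = coord y j) : vFun l x i = vFun l' y i := by
  induction i with
  | zero => rfl
  | succ i ih =>
    rw [vFun, vFun, ih (fun j hj => hl j (by omega)) (fun j hj => hx j (by omega)),
      hl _ le_rfl, hx _ le_rfl]

theorem omegaFun_congr {l l' : ℕ → ℝ} {x y : Fin n → ℝ} (i : ℕ) (hl : ∀ j < i, l j = l' j)
    (hx : ∀ j ≤ i, coord x j = coord y j) : omegaFun l x i = omegaFun l' y i := by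
  rcases i with _ | i
  · simp [omegaFun, vFun]
  · rw [omegaFun, omegaFun, hx _ le_rfl, vFun_congr _ (fun j hj => hl j (by omega))
      (fun j hj => hx j (by omega))]

theorem wFun_congr {l l' : ℕ → ℝ} {x y : Fin n → ℝ} (i : ℕ) (hl : ∀ j < i, l j = l' j)
    (hx : ∀ j ≤ i, coord x j = coord y j) : wFun l x i = wFun l' y i := by
  rcases i with _ | i
  · simp [wFun, vFun]
  · rw [wFun, wFun, hx _ le_rfl, vFun_congr (l := l) (l' := l') _ (fun j hj => hl j (by omega))
      (fun j hj => hx j (by omega))]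

theorem contDiff_zFun (hn : 2 ≤ n) (l : ℕ → ℝ) {i : ℕ} (hi : i < n) :
    ContDiff ℝ 1 fun x : Fin n → ℝ => zFun l x i := by
  induction i with
  | zero => simp only [zFun_zero]; exact contDiff_const
  | succ i ih =>
    simp only [zFun_succ]
    refine contDiff_const.mul ?_
    rcases Nat.eq_zero_or_pos i with rfl | h0
    · have h0 : (2 : ℝ) ≤ n := by exact_mod_cast hn
      have key : ∀ x : Fin n → ℝ, spow (omegaFun l x (0 + 1))
          (wt n (0 + 2) / (wt n (0 + 1) * beta n 0) * beta n (0 + 1)) = coord x 1 := by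
        intro x
        rw [exponent_mul_beta hn hi, omegaFun_succ, zFun_zero, sub_zero, spow_spow, beta]
        convert spow_one _ using 2
        have : (n : ℝ) - 1 ≠ 0 := by linarith
        push_cast
        field_simp
        simpa using ⟨this, by omega⟩
      simp only [key]
      exact contDiff_coord 1
    · simp only [omegaFun_succ]
      exact (contDiff_spow (one_lt_exponent_mul_beta hn hi)).comp
        (((contDiff_spow (one_lt_beta hn h0 (by omega))).comp (contDiff_coord _)).sub
          (ih (by omega)))

theorem contDiff_omegaFun (hn : 2 ≤ n) (l : ℕ → ℝ) {i : ℕ} (h0 : 1 ≤ i) (hi : i < n) :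
    ContDiff ℝ 1 fun x : Fin n → ℝ => omegaFun l x (i + 1) := by
  simp only [omegaFun_succ]
  exact ((contDiff_spow (one_lt_beta hn h0 hi)).comp (contDiff_coord _)).sub
    (contDiff_zFun hn l hi)

theorem continuous_omegaFun (hn : 2 ≤ n) (l : ℕ → ℝ) {i : ℕ} (hi : i < n) :
    Continuous fun x : Fin n → ℝ => omegaFun l x (i + 1) := by
  simp only [omegaFun_succ]
  exact ((continuous_spow (beta_pos hn hi)).comp (contDiff_coord _).continuous).sub
    (contDiff_zFun hn l hi).continuous

/-- `W_{i+1}` is the gap in Young's inequality for `x_{i+1}` and `⌊v_i⌉^β_i`. -/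
theorem wFun_succ (hn : 2 ≤ n) (l : ℕ → ℝ) (x : Fin n → ℝ) {i : ℕ} (hi : i < n) :
    wFun l x (i + 1) = |coord x (i + 1)| ^ (beta n i + 1) / (beta n i + 1) +
      |zFun l x i| ^ ((beta n i + 1) / beta n i) / ((beta n i + 1) / beta n i) -
        coord x (i + 1) * zFun l x i := by
  have hb := beta_pos hn hi
  have h1 : |zFun l x i| ^ ((beta n i + 1) / beta n i) = |vFun l x i| ^ (beta n i + 1) := by
    rw [zFun, abs_spow _ hb.ne', ← Real.rpow_mul (abs_nonneg _), mul_div_cancel₀ _ hb.ne']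
  have h2 : vFun l x i * zFun l x i = |vFun l x i| ^ (beta n i + 1) := mul_spow _ hb.le
  rw [h1, ← h2]
  change (_ - |vFun l x i| ^ (beta n i + 1)) / (beta n i + 1) - zFun l x i * _ = _
  rw [← h2]
  have h3 : beta n i + 1 ≠ 0 := by linarith
  simp only [Nat.add_sub_cancel]
  field_simp
  ring

theorem wFun_nonneg (hn : 2 ≤ n) (l : ℕ → ℝ) (x : Fin n → ℝ) {i : ℕ} (hi : i < n) :
    0 ≤ wFun l x (i + 1) := by
  have hb := beta_pos hn hi
  rw [wFun_succ hn l x hi, sub_nonneg]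
  refine Real.young_inequality _ _ ?_
  rw [Real.holderConjugate_iff]
  refine ⟨by linarith, ?_⟩
  field_simp
  ring

theorem contDiff_wFun (hn : 2 ≤ n) (l : ℕ → ℝ) {i : ℕ} (hi : i < n) :
    ContDiff ℝ 1 fun x : Fin n → ℝ => wFun l x (i + 1) := by
  have hb := beta_pos hn hi
  simp only [wFun_succ hn l _ hi]
  have hz := contDiff_zFun hn l hi
  have hc := contDiff_coord (n := n) (i + 1)
  refine ContDiff.sub (ContDiff.add ?_ ?_) (hc.mul hz)
  · exact ((contDiff_abs_rpow (by linarith)).comp hc).div_const _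
  · exact ((contDiff_abs_rpow (by rw [lt_div_iff₀ hb]; linarith)).comp hz).div_const _

theorem coord_eq_vFun_of_omegaFun_eq_zero (hn : 2 ≤ n) {l : ℕ → ℝ} {x : Fin n → ℝ} {i : ℕ}
    (hi : i < n) (h : omegaFun l x (i + 1) = 0) : coord x (i + 1) = vFun l x i :=
  spow_injective (beta_pos hn hi).ne' (sub_eq_zero.1 h)

theorem wFun_eq_zero_of_omegaFun_eq_zero (hn : 2 ≤ n) {l : ℕ → ℝ} {x : Fin n → ℝ} {i : ℕ}
    (hi : i < n) (h : omegaFun l x (i + 1) = 0) : wFun l x (i + 1) = 0 := by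
  rw [wFun, coord_eq_vFun_of_omegaFun_eq_zero hn hi h]
  simp

theorem fderiv_wFun_eq_zero (hn : 2 ≤ n) {l : ℕ → ℝ} {x : Fin n → ℝ} {i : ℕ} (hi : i < n)
    (h : wFun l x (i + 1) = 0) : fderiv ℝ (fun y : Fin n → ℝ => wFun l y (i + 1)) x = 0 := by
  apply IsLocalMin.fderiv_eq_zero
  exact Eventually.of_forall fun y => by simpa only [h] using wFun_nonneg hn l y hi

/-- The derivative of `W_{i+1}` in the direction of `x_{i+1}` is `ω_{i+1}`. -/
theorem fderiv_wFun_unitVec (hn : 2 ≤ n) (l : ℕ → ℝ) (x : Fin n → ℝ) {i : ℕ} (hi : i < n) :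
    fderiv ℝ (fun y : Fin n → ℝ => wFun l y (i + 1)) x (unitVec n (i + 1)) =
      omegaFun l x (i + 1) := by
  have hb := beta_pos hn hi
  have hd := ((contDiff_wFun hn l hi).differentiable one_ne_zero x).hasFDerivAt
  have hline := hd.hasLineDerivAt (unitVec n (i + 1))
  have hz : ∀ t : ℝ, zFun l (x + t • unitVec n (i + 1)) i = zFun l x i := by
    intro t
    rw [zFun, zFun, vFun_congr i (fun _ _ => rfl) (fun j hj => ?_)]
    rw [coord_add, coord_smul, coord_unitVec _ _ (by omega) (by omega), if_neg (by omega)]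
    simp
  have hc : ∀ t : ℝ, coord (x + t • unitVec n (i + 1)) (i + 1) = coord x (i + 1) + t := by
    intro t
    rw [coord_add, coord_smul, coord_unitVec _ _ (by omega) (by omega)]
    simp
  have h2 : HasDerivAt (fun t : ℝ => wFun l (x + t • unitVec n (i + 1)) (i + 1))
      (omegaFun l x (i + 1)) 0 := by
    simp only [wFun_succ hn l _ hi, hz, hc]
    have h3 : HasDerivAt (fun t : ℝ => coord x (i + 1) + t) 1 0 :=
      (hasDerivAt_id _).const_add _
    have h4 := (hasDerivAt_abs_rpow_eq_spow hb (coord x (i + 1) + 0)).comp (0 : ℝ) h3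
    have h5 := ((h4.div_const (beta n i + 1)).add_const
      (|zFun l x i| ^ ((beta n i + 1) / beta n i) / ((beta n i + 1) / beta n i))).sub
        (h3.mul_const (zFun l x i))
    refine h5.congr_deriv ?_
    have h6 : beta n i + 1 ≠ 0 := by linarith
    rw [omegaFun_succ, add_zero]
    field_simp
  exact hline.unique h2

end Structure

/-! ### Weighted homogeneity -/

section Homogeneity

variable {n : ℕ}

/-- The weighted dilation `x_i ↦ r^{p_i} x_i`. -/
noncomputable def dilation (n : ℕ) (r : ℝ) : (Fin n → ℝ) →L[ℝ] (Fin n → ℝ) :=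
  ContinuousLinearMap.pi fun j => r ^ wt n (j + 1) • ContinuousLinearMap.proj j

theorem dilation_apply (r : ℝ) (x : Fin n → ℝ) (j : Fin n) :
    dilation n r x j = r ^ wt n (j + 1) * x j := by
  simp [dilation]

theorem coord_dilation (r : ℝ) (x : Fin n → ℝ) (i : ℕ) :
    coord (dilation n r x) i = r ^ wt n i * coord x i := by
  unfold coord
  split_ifs with h
  · simp only [dilation_apply]
    rw [Nat.sub_add_cancel h.1]
  · simp

/-- Homogeneity of degree `m` with respect to the weighted dilations. -/
def IsHomogeneous (f : (Fin n → ℝ) → ℝ) (m : ℝ) : Prop :=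
  ∀ r > 0, ∀ x, f (dilation n r x) = r ^ m * f x

theorem IsHomogeneous.rpow {f : (Fin n → ℝ) → ℝ} {m : ℝ} (hf : IsHomogeneous f m)
    (h0 : ∀ x, 0 ≤ f x) (a : ℝ) : IsHomogeneous (fun x => f x ^ a) (m * a) := by
  intro r hr x
  simp only
  rw [hf r hr, Real.mul_rpow (by positivity) (h0 x), ← Real.rpow_mul hr.le]

theorem IsHomogeneous.abs {f : (Fin n → ℝ) → ℝ} {m : ℝ} (hf : IsHomogeneous f m) :
    IsHomogeneous (fun x => |f x|) m := by
  intro r hr x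
  simp only
  rw [hf r hr, abs_mul, abs_of_pos (Real.rpow_pos_of_pos hr _)]

theorem isHomogeneous_coord (i : ℕ) : IsHomogeneous (fun x : Fin n → ℝ => coord x i) (wt n i) :=
  fun r _ x => coord_dilation r x i

theorem exists_dilation_eq (hn : 2 ≤ n) {x : Fin n → ℝ} (hx : x ≠ 0) :
    ∃ r > 0, ∃ y : Fin n → ℝ, ‖y‖ = 1 ∧ x = dilation n r y := by
  have : Nonempty (Fin n) := ⟨⟨0, by omega⟩⟩
  have hw : ∀ j : Fin n, 0 < wt n (j + 1) := fun j => wt_succ_pos hn j.isLt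
  obtain ⟨i, hi⟩ := Finite.exists_max fun j : Fin n => |x j| ^ (wt n (j + 1))⁻¹
  set r := |x i| ^ (wt n (i + 1))⁻¹ with hr
  have hxi : 0 < |x i| := by
    rw [abs_pos]
    intro h0
    apply hx
    ext j
    have h1 := hi j
    rw [hr, h0, abs_zero, Real.zero_rpow (inv_pos.2 (hw i)).ne'] at h1
    by_contra h2
    exact absurd (Real.rpow_pos_of_pos (abs_pos.2 h2) (wt n (j + 1))⁻¹) (not_lt.2 h1)
  have hr0 : 0 < r := Real.rpow_pos_of_pos hxi _
  have hrj : ∀ j : Fin n, |x j| ≤ r ^ wt n (j + 1) := by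
    intro j
    have h1 := Real.rpow_le_rpow (by positivity) (hi j) (hw j).le
    rwa [← Real.rpow_mul (abs_nonneg _), inv_mul_cancel₀ (hw j).ne', Real.rpow_one] at h1
  have hri : |x i| = r ^ wt n (i + 1) := by
    rw [hr, ← Real.rpow_mul (abs_nonneg _), inv_mul_cancel₀ (hw i).ne', Real.rpow_one]
  refine ⟨r, hr0, fun j => (r ^ wt n (j + 1))⁻¹ * x j, ?_, ?_⟩
  · apply le_antisymm
    · refine (pi_norm_le_iff_of_nonneg zero_le_one).2 fun j => ?_
      have h1 : 0 < r ^ wt n (j + 1) := Real.rpow_pos_of_pos hr0 _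
      rw [Real.norm_eq_abs, abs_mul, abs_of_pos (inv_pos.2 h1), inv_mul_le_iff₀ h1, mul_one]
      exact hrj j
    · refine le_trans (le_of_eq ?_) (norm_le_pi_norm _ i)
      have h1 : 0 < r ^ wt n (i + 1) := Real.rpow_pos_of_pos hr0 _
      rw [Real.norm_eq_abs, abs_mul, abs_of_pos (inv_pos.2 h1), hri, inv_mul_cancel₀ h1.ne']
  · ext j
    rw [dilation_apply, mul_inv_cancel_left₀ (Real.rpow_pos_of_pos hr0 _).ne']

/-- A continuous homogeneous function is dominated by every positive continuous homogeneous
function of the same degree. -/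
theorem IsHomogeneous.exists_le_mul (hn : 2 ≤ n) {f g : (Fin n → ℝ) → ℝ} {m : ℝ}
    (hf : IsHomogeneous f m) (hg : IsHomogeneous g m) (hfc : Continuous f) (hgc : Continuous g)
    (hpos : ∀ x, x ≠ 0 → 0 < g x) : ∃ C > 0, ∀ x, x ≠ 0 → f x ≤ C * g x := by
  have hS : ∀ y ∈ Metric.sphere (0 : Fin n → ℝ) 1, 0 < g y := fun y hy =>
    hpos y (by rintro rfl; simp at hy)
  obtain ⟨C, hC⟩ := (isCompact_sphere (0 : Fin n → ℝ) 1).exists_bound_of_continuousOn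
    (f := fun y => f y / g y) (hfc.continuousOn.div hgc.continuousOn fun y hy => (hS y hy).ne')
  refine ⟨|C| + 1, by positivity, fun x hx => ?_⟩
  obtain ⟨r, hr, y, hy, rfl⟩ := exists_dilation_eq hn hx
  have hy' : y ∈ Metric.sphere (0 : Fin n → ℝ) 1 := by simpa using hy
  have h1 : f y / g y ≤ |C| + 1 := by
    have := (le_abs_self _).trans ((hC y hy').trans (le_abs_self C))
    linarith
  rw [div_le_iff₀ (hS y hy')] at h1
  rw [hf r hr, hg r hr, mul_left_comm]
  exact mul_le_mul_of_nonneg_left h1 (by positivity)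

/-- If `f < 0` wherever the nonnegative function `g` vanishes, then `f < L g` for a large `L`;
the functions are restricted to the subspace of the first `i` coordinates. -/
theorem IsHomogeneous.exists_lt_mul (hn : 2 ≤ n) {f g : (Fin n → ℝ) → ℝ} {m : ℝ} (i : ℕ)
    (hf : IsHomogeneous f m) (hg : IsHomogeneous g m) (hfc : Continuous f) (hgc : Continuous g)
    (h0 : ∀ x, 0 ≤ g x)
    (hneg : ∀ x, x ≠ 0 → (∀ j, i < j → coord x j = 0) → g x = 0 → f x < 0) :
    ∃ L > 0, ∀ x, x ≠ 0 → (∀ j, i < j → coord x j = 0) → f x < L * g x := by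
  set D : Set (Fin n → ℝ) := {x | ∀ j, i < j → coord x j = 0} with hD
  have hDc : IsClosed D := by
    simp only [hD, ofPred_forall]
    exact isClosed_iInter fun j => isClosed_iInter fun _ =>
      isClosed_eq (contDiff_coord j).continuous continuous_const
  have hK : IsCompact (Metric.sphere (0 : Fin n → ℝ) 1 ∩ D) :=
    (isCompact_sphere _ _).inter_right hDc
  obtain ⟨k, hk⟩ := hK.elim_directed_cover (fun k : ℕ => {x | f x < k * g x})
    (fun k => isOpen_lt hfc (continuous_const.mul hgc))
    (fun x hx => by
      simp only [mem_iUnion, mem_ofPred_eq]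
      rcases (h0 x).eq_or_lt with h | h
      · exact ⟨0, by simpa using hneg x (by rintro rfl; simp at hx) hx.2 h.symm⟩
      · obtain ⟨k, hk⟩ := exists_nat_gt (f x / g x)
        exact ⟨k, (div_lt_iff₀ h).1 hk⟩)
    (Monotone.directed_le fun a b hab x hx => by
      simp only [mem_ofPred_eq] at hx ⊢
      refine hx.trans_le (mul_le_mul_of_nonneg_right (by exact_mod_cast hab) (h0 x)))
  refine ⟨k + 1, by positivity, fun x hx hxD => ?_⟩
  obtain ⟨r, hr, y, hy, rfl⟩ := exists_dilation_eq hn hx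
  have hyD : y ∈ D := fun j hj => by
    have := hxD j hj
    rw [coord_dilation] at this
    exact (mul_eq_zero.1 this).resolve_left (Real.rpow_pos_of_pos hr _).ne'
  have h1 : f y < k * g y := hk ⟨by simpa using hy, hyD⟩
  rw [hf r hr, hg r hr, mul_left_comm]
  refine mul_lt_mul_of_pos_left ?_ (by positivity)
  nlinarith [h0 y]

theorem isHomogeneous_vFun (hn : 2 ≤ n) (l : ℕ → ℝ) {i : ℕ} (hi : i < n) :
    IsHomogeneous (fun x : Fin n → ℝ => vFun l x i) (wt n (i + 1)) := by
  intro r hr x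
  induction i with
  | zero => simp [vFun]
  | succ i ih =>
    have h1 := ih (by omega)
    simp only at h1 ⊢
    have h2 := wt_mul_beta_pos hn (show i < n by omega)
    have h3 : omegaFun l (dilation n r x) (i + 1) =
        r ^ (wt n (i + 1) * beta n i) * omegaFun l x (i + 1) := by
      simp only [omegaFun, Nat.add_sub_cancel]
      rw [h1, coord_dilation, spow_mul_left, spow_mul_left, spow_of_pos (by positivity),
        ← Real.rpow_mul hr.le]
      ring
    rw [vFun_succ, vFun_succ, h3, spow_mul_left, spow_of_pos (by positivity),
      ← Real.rpow_mul hr.le, mul_div_cancel₀ _ h2.ne']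
    ring

theorem isHomogeneous_omegaFun (hn : 2 ≤ n) (l : ℕ → ℝ) {i : ℕ} (hi : i < n) :
    IsHomogeneous (fun x : Fin n → ℝ => omegaFun l x (i + 1)) (((n : ℝ) - 1 + i) / n) := by
  intro r hr x
  simp only [omegaFun, Nat.add_sub_cancel]
  rw [(show vFun l (dilation n r x) i = _ from isHomogeneous_vFun hn l hi r hr x), coord_dilation,
    spow_mul_left, spow_mul_left,
    spow_of_pos (by positivity), ← Real.rpow_mul hr.le, wt_mul_beta hn hi]
  ring

theorem isHomogeneous_wFun (hn : 2 ≤ n) (l : ℕ → ℝ) {i : ℕ} (hi : i < n) :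
    IsHomogeneous (fun x : Fin n → ℝ => wFun l x (i + 1)) ((2 * (n : ℝ) - 1) / n) := by
  intro r hr x
  have h1 : r ^ ((2 * (n : ℝ) - 1) / n) = (r ^ wt n (i + 1)) ^ (beta n i + 1) := by
    rw [← Real.rpow_mul hr.le, wt_mul_beta_add_one hn hi]
  have h2 : 0 < r ^ wt n (i + 1) := by positivity
  simp only [wFun, Nat.add_sub_cancel]
  rw [(show vFun l (dilation n r x) i = _ from isHomogeneous_vFun hn l hi r hr x), coord_dilation,
    h1, abs_mul, abs_mul, abs_of_pos h2,
    Real.mul_rpow h2.le (abs_nonneg _), Real.mul_rpow h2.le (abs_nonneg _), spow_mul_left,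
    spow_of_pos h2, Real.rpow_add_one h2.ne']
  ring

end Homogeneity

/-! ### The partial Lyapunov functions -/

section Lyapunov

variable {n : ℕ}

/-- The partial sums `W_1 + ⋯ + W_i` of the Lyapunov function. -/
noncomputable def partialLyap (l : ℕ → ℝ) (i : ℕ) (x : Fin n → ℝ) : ℝ :=
  ∑ j ∈ Finset.range i, wFun l x (j + 1)

theorem lyap_eq_partialLyap (l : ℕ → ℝ) : lyap l = partialLyap (n := n) l n := by
  ext x
  rw [lyap, partialLyap, Finset.range_eq_Ico, Finset.sum_Ico_add' (fun j => wFun l x j)]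
  rfl

theorem partialLyap_succ (l : ℕ → ℝ) (i : ℕ) :
    partialLyap (n := n) l (i + 1) = fun x => partialLyap l i x + wFun l x (i + 1) := by
  ext x
  rw [partialLyap, Finset.sum_range_succ, partialLyap]

theorem partialLyap_congr {l l' : ℕ → ℝ} {x y : Fin n → ℝ} (i : ℕ) (hl : ∀ j < i, l j = l' j)
    (hx : ∀ j ≤ i, coord x j = coord y j) : partialLyap l i x = partialLyap l' i y := by
  refine Finset.sum_congr rfl fun j hj => ?_
  have := Finset.mem_range.1 hj
  exact wFun_congr _ (fun k hk => hl k (by omega)) (fun k hk => hx k (by omega))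

theorem contDiff_partialLyap (hn : 2 ≤ n) (l : ℕ → ℝ) {i : ℕ} (hi : i ≤ n) :
    ContDiff ℝ 1 (partialLyap (n := n) l i) := by
  refine ContDiff.sum fun j hj => contDiff_wFun hn l ?_
  have := Finset.mem_range.1 hj
  omega

theorem isHomogeneous_partialLyap (hn : 2 ≤ n) (l : ℕ → ℝ) {i : ℕ} (hi : i ≤ n) :
    IsHomogeneous (partialLyap (n := n) l i) ((2 * (n : ℝ) - 1) / n) := by
  intro r hr x
  rw [partialLyap, partialLyap, Finset.mul_sum]
  refine Finset.sum_congr rfl fun j hj => isHomogeneous_wFun hn l ?_ r hr x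
  have := Finset.mem_range.1 hj
  omega

theorem fderiv_partialLyap_succ (hn : 2 ≤ n) (l : ℕ → ℝ) {i : ℕ} (hi : i < n)
    (x : Fin n → ℝ) : fderiv ℝ (partialLyap l (i + 1)) x =
      fderiv ℝ (partialLyap l i) x + fderiv ℝ (fun y : Fin n → ℝ => wFun l y (i + 1)) x := by
  rw [partialLyap_succ]
  exact fderiv_fun_add ((contDiff_partialLyap hn l hi.le).differentiable one_ne_zero x)
    ((contDiff_wFun hn l hi).differentiable one_ne_zero x)

theorem partialLyap_add_unitVec (l : ℕ → ℝ) {i : ℕ} (hi : i < n) (x : Fin n → ℝ) (c : ℝ) :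
    partialLyap l i (x + c • unitVec n (i + 1)) = partialLyap l i x := by
  refine partialLyap_congr i (fun _ _ => rfl) fun j hj => ?_
  rw [coord_add, coord_smul, coord_unitVec _ _ (by omega) (by omega), if_neg (by omega)]
  simp

theorem fderiv_partialLyap_add_unitVec (l : ℕ → ℝ) {i : ℕ} (hi : i < n) (x : Fin n → ℝ)
    (c : ℝ) : fderiv ℝ (partialLyap l i) (x + c • unitVec n (i + 1)) =
      fderiv ℝ (partialLyap l i) x := by
  rw [← fderiv_comp_add_right]
  simp only [partialLyap_add_unitVec l hi]

theorem fderiv_partialLyap_unitVec (hn : 2 ≤ n) (l : ℕ → ℝ) {i : ℕ} (hi : i < n)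
    (x : Fin n → ℝ) : fderiv ℝ (partialLyap l (i + 1)) x (unitVec n (i + 1)) =
      omegaFun l x (i + 1) := by
  rw [fderiv_partialLyap_succ hn l hi, add_apply, fderiv_wFun_unitVec hn l x hi]
  have hd := ((contDiff_partialLyap hn l hi.le).differentiable one_ne_zero x).hasFDerivAt
  have h1 := hd.hasLineDerivAt (unitVec n (i + 1))
  have h2 : HasLineDerivAt ℝ (partialLyap l i) 0 x (unitVec n (i + 1)) := by
    simp only [HasLineDerivAt, partialLyap_add_unitVec l hi]
    exact hasDerivAt_const _ _
  rw [h1.unique h2, zero_add]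

theorem partialLyap_nonneg (hn : 2 ≤ n) (l : ℕ → ℝ) {i : ℕ} (hi : i ≤ n) (x : Fin n → ℝ) :
    0 ≤ partialLyap l i x := by
  refine Finset.sum_nonneg fun j hj => wFun_nonneg hn l x ?_
  have := Finset.mem_range.1 hj
  omega

theorem lyap_nonneg (hn : 2 ≤ n) (l : ℕ → ℝ) (x : Fin n → ℝ) : 0 ≤ lyap l x := by
  rw [lyap_eq_partialLyap]
  exact partialLyap_nonneg hn l le_rfl x

theorem contDiff_lyap (hn : 2 ≤ n) (l : ℕ → ℝ) : ContDiff ℝ 1 (lyap (n := n) l) := by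
  rw [lyap_eq_partialLyap]
  exact contDiff_partialLyap hn l le_rfl

theorem vFun_zero_left (l : ℕ → ℝ) (i : ℕ) : vFun l (0 : Fin n → ℝ) i = 0 := by
  induction i with
  | zero => rfl
  | succ i ih => simp [vFun, ih]

theorem omegaFun_zero_left (l : ℕ → ℝ) (i : ℕ) : omegaFun l (0 : Fin n → ℝ) i = 0 := by
  simp [omegaFun, vFun_zero_left]

theorem lyap_zero (hn : 2 ≤ n) (l : ℕ → ℝ) : lyap l (0 : Fin n → ℝ) = 0 := by
  rw [lyap_eq_partialLyap]
  refine Finset.sum_eq_zero fun j hj => ?_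
  exact wFun_eq_zero_of_omegaFun_eq_zero hn (Finset.mem_range.1 hj) (omegaFun_zero_left l _)

theorem eq_zero_of_lyap_eq_zero (hn : 2 ≤ n) {l : ℕ → ℝ} {x : Fin n → ℝ} (h : lyap l x = 0) :
    x = 0 := by
  rw [lyap_eq_partialLyap, partialLyap, Finset.sum_eq_zero_iff_of_nonneg
    fun j hj => wFun_nonneg hn l x (Finset.mem_range.1 hj)] at h
  have hω : ∀ i < n, omegaFun l x (i + 1) = 0 := by
    intro i hi
    rw [← fderiv_wFun_unitVec hn l x hi, fderiv_wFun_eq_zero hn hi (h i (Finset.mem_range.2 hi))]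
    rfl
  have hv : ∀ i < n, vFun l x i = 0 := by
    intro i hi
    rcases i with _ | i
    · rfl
    · rw [vFun_succ, hω i (by omega)]
      simp
  ext j
  rw [← coord_succ x j, coord_eq_vFun_of_omegaFun_eq_zero hn j.isLt (hω j j.isLt), hv j j.isLt]
  rfl

theorem lyap_pos (hn : 2 ≤ n) (l : ℕ → ℝ) {x : Fin n → ℝ} (hx : x ≠ 0) : 0 < lyap l x :=
  (lyap_nonneg hn l x).lt_of_ne fun h => hx (eq_zero_of_lyap_eq_zero hn h.symm)

theorem isHomogeneous_lyap_rpow (hn : 2 ≤ n) (l : ℕ → ℝ) :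
    IsHomogeneous (fun x : Fin n → ℝ => lyap l x ^ (2 * ((n : ℝ) - 1) / (2 * n - 1)))
      (2 * ((n : ℝ) - 1) / n) := by
  have h0 : (2 : ℝ) ≤ n := by exact_mod_cast hn
  have h := (isHomogeneous_partialLyap hn l le_rfl).rpow (partialLyap_nonneg hn l le_rfl)
    (2 * ((n : ℝ) - 1) / (2 * n - 1))
  rw [lyap_eq_partialLyap]
  convert h using 1
  have : 2 * (n : ℝ) - 1 ≠ 0 := by linarith
  field_simp

theorem lyap_exponent_pos (hn : 2 ≤ n) : 0 < 2 * ((n : ℝ) - 1) / (2 * n - 1) := by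
  have h0 : (2 : ℝ) ≤ n := by exact_mod_cast hn
  exact div_pos (by linarith) (by linarith)

theorem lyap_exponent_le_one (hn : 2 ≤ n) : 2 * ((n : ℝ) - 1) / (2 * n - 1) ≤ 1 := by
  have h0 : (2 : ℝ) ≤ n := by exact_mod_cast hn
  rw [div_le_one (by linarith)]
  linarith

theorem continuous_lyap_rpow (hn : 2 ≤ n) (l : ℕ → ℝ) :
    Continuous fun x : Fin n → ℝ => lyap l x ^ (2 * ((n : ℝ) - 1) / (2 * n - 1)) :=
  (contDiff_lyap hn l).continuous.rpow_const fun _ => Or.inr (lyap_exponent_pos hn).le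

/-! ### Existence of admissible gains -/

theorem jordanBlock_mulVec_dilation (hn : 2 ≤ n) {r : ℝ} (hr : 0 < r) (x : Fin n → ℝ) :
    (jordanBlock n).mulVec (dilation n r x) =
      r ^ (-(1 : ℝ) / n) • dilation n r ((jordanBlock n).mulVec x) := by
  have h0 : (n : ℝ) ≠ 0 := by exact_mod_cast (by omega : n ≠ 0)
  ext j
  rw [jordanBlock_mulVec_apply, coord_dilation, Pi.smul_apply, dilation_apply,
    jordanBlock_mulVec_apply, smul_eq_mul, ← mul_assoc, ← Real.rpow_add hr]
  congr 2
  rw [show j.val + 2 = (j.val + 1) + 1 from rfl, wt_succ hn, wt_succ hn]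
  push_cast
  field_simp
  ring

theorem isHomogeneous_fderiv_partialLyap (hn : 2 ≤ n) (l : ℕ → ℝ) {i : ℕ} (hi : i ≤ n) :
    IsHomogeneous (fun x : Fin n → ℝ =>
      fderiv ℝ (partialLyap l i) x ((jordanBlock n).mulVec x)) (2 * ((n : ℝ) - 1) / n) := by
  intro r hr x
  have hd := (contDiff_partialLyap hn l hi).differentiable one_ne_zero
  have h1 : (fderiv ℝ (partialLyap l i) (dilation n r x)).comp (dilation n r) =
      r ^ ((2 * (n : ℝ) - 1) / n) • fderiv ℝ (partialLyap l i) x := by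
    have h2 := (hd (dilation n r x)).hasFDerivAt.comp x (dilation n r).hasFDerivAt
    have h3 := (hd x).hasFDerivAt.const_mul (r ^ ((2 * (n : ℝ) - 1) / n))
    refine h2.unique (h3.congr_of_eventuallyEq (Eventually.of_forall fun y => ?_))
    exact isHomogeneous_partialLyap hn l hi r hr y
  have h4 := DFunLike.congr_fun h1 ((jordanBlock n).mulVec x)
  simp only [ContinuousLinearMap.comp_apply, smul_apply, smul_eq_mul] at h4
  simp only
  rw [jordanBlock_mulVec_dilation hn hr, map_smul, smul_eq_mul, h4, ← mul_assoc,
    ← Real.rpow_add hr]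
  congr 2
  ring

theorem continuous_fderiv_partialLyap (hn : 2 ≤ n) (l : ℕ → ℝ) {i : ℕ} (hi : i ≤ n) :
    Continuous (fun x : Fin n → ℝ =>
      fderiv ℝ (partialLyap l i) x ((jordanBlock n).mulVec x)) :=
  ((contDiff_partialLyap hn l hi).continuous_fderiv one_ne_zero).clm_apply
    (Continuous.matrix_mulVec continuous_const continuous_id)

/-- Where `ω_{i+1} = 0`, the derivative of `W_1 + ⋯ + W_{i+1}` along the chain of the first `i + 1`
coordinates is the one of `W_1 + ⋯ + W_i` along the chain closed by `x_{i+1} = v_i`. -/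
theorem fderiv_partialLyap_succ_neg (hn : 2 ≤ n) {l : ℕ → ℝ} {i : ℕ} (hi : i < n)
    (hneg : ∀ x : Fin n → ℝ, x ≠ 0 → (∀ j, i < j → coord x j = 0) →
      fderiv ℝ (partialLyap l i) x ((jordanBlock n).mulVec x) + omegaFun l x i * vFun l x i < 0)
    {x : Fin n → ℝ} (hx : x ≠ 0) (hxD : ∀ j, i + 1 < j → coord x j = 0)
    (hω : omegaFun l x (i + 1) = 0) :
    fderiv ℝ (partialLyap l (i + 1)) x ((jordanBlock n).mulVec x) < 0 := by
  have hxv := coord_eq_vFun_of_omegaFun_eq_zero hn hi hω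
  set c := coord x (i + 1) with hc
  set y := x - c • unitVec n (i + 1) with hy
  have hxy : x = y + c • unitVec n (i + 1) := by rw [hy]; abel
  have hcy : ∀ j, coord x j = coord y j + c * if j = i + 1 then 1 else 0 := by
    intro j
    rw [← coord_unitVec (n := n) (i + 1) j (by omega) (by omega), ← coord_smul, ← coord_add, ← hxy]
  have hyx : ∀ j ≤ i, coord x j = coord y j := fun j hj => by
    rw [hcy j, if_neg (by omega)]; simp
  have hv : c = vFun l y i := by
    rw [hxv]; exact vFun_congr i (fun _ _ => rfl) hyx
  have hy0 : y ≠ 0 := by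
    intro h0
    rw [h0, vFun_zero_left] at hv
    rw [hxy, h0, hv] at hx
    simp at hx
  have hyD : ∀ j, i < j → coord y j = 0 := by
    intro j hj
    rcases (Nat.succ_le_of_lt hj).eq_or_lt with h | h
    · have := hcy j
      rw [← h, if_pos rfl] at this
      rw [← h]
      simp only [Nat.succ_eq_add_one] at this ⊢
      linarith
    · have := hcy j
      rw [hxD j h, if_neg (by omega)] at this
      linarith
  rw [fderiv_partialLyap_succ hn l hi,
    fderiv_wFun_eq_zero hn hi (wFun_eq_zero_of_omegaFun_eq_zero hn hi hω), add_zero]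
  rcases i with _ | i
  · exact absurd (funext fun j => by rw [← coord_succ y j, hyD _ (by omega)]; rfl) hy0
  · have h1 := hneg y hy0 hyD
    rw [hxy, fderiv_partialLyap_add_unitVec l hi, Matrix.mulVec_add, Matrix.mulVec_smul,
      jordanBlock_mulVec_unitVec _ (by omega), map_add, map_smul,
      fderiv_partialLyap_unitVec hn l (by omega), smul_eq_mul, mul_comm, hv]
    exact h1

theorem vFun_mul_omegaFun (hn : 2 ≤ n) (l : ℕ → ℝ) (x : Fin n → ℝ) {i : ℕ} (hi : i < n) :
    omegaFun l x (i + 1) * vFun l x (i + 1) =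
      -(l (i + 1) * |omegaFun l x (i + 1)| ^ (2 * ((n : ℝ) - 1) / (n - 1 + i))) := by
  have h0 : (2 : ℝ) ≤ n := by exact_mod_cast hn
  have h2 : ((i + 1 : ℕ) : ℝ) ≤ n := by exact_mod_cast hi
  have h3 : (0 : ℝ) ≤ i := i.cast_nonneg
  have h4 : (n : ℝ) - 1 + i ≠ 0 := by linarith
  have h5 : wt n (i + 2) / (wt n (i + 1) * beta n i) = ((n : ℝ) - (i + 1)) / (n - 1 + i) := by
    rw [wt_mul_beta hn hi, show i + 2 = (i + 1) + 1 from rfl, wt_succ hn]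
    push_cast
    field_simp
  push_cast at h2
  rw [vFun_succ, h5, mul_left_comm, mul_spow _ (div_nonneg (by linarith) (by linarith)),
    show ((n : ℝ) - (i + 1)) / (n - 1 + i) + 1 = 2 * ((n : ℝ) - 1) / (n - 1 + i) by
      field_simp; ring]
  ring

theorem exists_gains (hn : 2 ≤ n) (i : ℕ) (hi : i ≤ n) : ∃ l : ℕ → ℝ, (∀ j, 0 < l j) ∧
    ∀ x : Fin n → ℝ, x ≠ 0 → (∀ j, i < j → coord x j = 0) →
      fderiv ℝ (partialLyap l i) x ((jordanBlock n).mulVec x) +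
        omegaFun l x i * vFun l x i < 0 := by
  induction i with
  | zero =>
    refine ⟨fun _ => 1, fun _ => one_pos, fun x hx hxD => absurd (funext fun j => ?_) hx⟩
    rw [← coord_succ x j, hxD _ (by omega)]
    rfl
  | succ i ih =>
    obtain ⟨l, hl, hneg⟩ := ih (by omega)
    have h0 : (2 : ℝ) ≤ n := by exact_mod_cast hn
    have h3 : (0 : ℝ) ≤ i := i.cast_nonneg
    have he : 0 < 2 * ((n : ℝ) - 1) / (n - 1 + i) := div_pos (by linarith) (by linarith)
    have hg : IsHomogeneous (fun x : Fin n → ℝ =>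
        |omegaFun l x (i + 1)| ^ (2 * ((n : ℝ) - 1) / (n - 1 + i))) (2 * ((n : ℝ) - 1) / n) := by
      convert (isHomogeneous_omegaFun hn l hi).abs.rpow (fun _ => abs_nonneg _)
        (2 * ((n : ℝ) - 1) / (n - 1 + i)) using 1
      have : (n : ℝ) - 1 + i ≠ 0 := by linarith
      field_simp
    obtain ⟨L, hL, hlt⟩ := (isHomogeneous_fderiv_partialLyap hn l hi).exists_lt_mul hn (i + 1) hg
      (continuous_fderiv_partialLyap hn l hi)
      ((continuous_omegaFun hn l hi).abs.rpow_const fun _ => Or.inr he.le)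
      (fun x => Real.rpow_nonneg (abs_nonneg _) _) (fun x hx hxD hgx => by
        rw [Real.rpow_eq_zero (abs_nonneg _) he.ne', abs_eq_zero] at hgx
        exact fderiv_partialLyap_succ_neg hn hi hneg hx hxD hgx)
    have hcongr : ∀ j < i + 1, Function.update l (i + 1) L j = l j := fun j hj =>
      Function.update_of_ne (by omega) _ _
    refine ⟨Function.update l (i + 1) L, fun j => ?_, fun x hx hxD => ?_⟩
    · rcases eq_or_ne j (i + 1) with rfl | h
      · simpa using hL
      · simpa [Function.update_of_ne h] using hl j
    · rw [vFun_mul_omegaFun hn _ x hi, omegaFun_congr (i + 1) hcongr fun _ _ => rfl,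
        show partialLyap (n := n) (Function.update l (i + 1) L) (i + 1) = partialLyap l (i + 1) from
          funext fun y => partialLyap_congr (i + 1) hcongr fun _ _ => rfl, Function.update_self]
      linarith [hlt x hx hxD]

theorem fderiv_lyap_lastVec (hn : 2 ≤ n) (l : ℕ → ℝ) (x : Fin n → ℝ) :
    fderiv ℝ (lyap l) x (lastVec n) = omegaFun l x n := by
  obtain ⟨i, rfl⟩ : ∃ i, n = i + 1 := ⟨n - 1, by omega⟩
  rw [lyap_eq_partialLyap]
  exact fderiv_partialLyap_unitVec hn l (Nat.lt_succ_self i) x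

theorem isHomogeneous_omegaFun_last (hn : 2 ≤ n) (l : ℕ → ℝ) :
    IsHomogeneous (fun x : Fin n → ℝ => omegaFun l x n) (2 * ((n : ℝ) - 1) / n) := by
  obtain ⟨i, rfl⟩ : ∃ i, n = i + 1 := ⟨n - 1, by omega⟩
  convert isHomogeneous_omegaFun hn l (Nat.lt_succ_self i) using 1
  push_cast
  ring

theorem contDiff_omegaFun_last (hn : 2 ≤ n) (l : ℕ → ℝ) :
    ContDiff ℝ 1 fun x : Fin n → ℝ => omegaFun l x n := by
  obtain ⟨i, rfl⟩ : ∃ i, n = i + 1 := ⟨n - 1, by omega⟩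
  exact contDiff_omegaFun hn l (by omega) (Nat.lt_succ_self i)

theorem mul_sign_eq_abs (x : ℝ) : x * Real.sign x = |x| := by
  rcases lt_trichotomy x 0 with h | rfl | h
  · simp [Real.sign_of_neg h, abs_of_neg h]
  · simp
  · simp [Real.sign_of_pos h, abs_of_pos h]

theorem exists_admissibleGains (hn : 2 ≤ n) : ∃ l : ℕ → ℝ, AdmissibleGains n l := by
  obtain ⟨l, hl, hneg⟩ := exists_gains hn n le_rfl
  have h0 : (2 : ℝ) ≤ n := by exact_mod_cast hn
  have hlast : ∀ x : Fin n → ℝ, omegaFun l x n * vFun l x n = -(l n * |omegaFun l x n|) := by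
    intro x
    obtain ⟨i, rfl⟩ : ∃ i, n = i + 1 := ⟨n - 1, by omega⟩
    rw [vFun_mul_omegaFun hn l x (Nat.lt_succ_self i)]
    push_cast at h0 ⊢
    have h1 : (i : ℝ) + 1 - 1 + i ≠ 0 := by linarith
    rw [show 2 * ((i : ℝ) + 1 - 1) / (i + 1 - 1 + i) = 1 by rw [div_eq_one_iff_eq h1]; ring,
      Real.rpow_one]
  set G : (Fin n → ℝ) → ℝ := fun x =>
    l n * |omegaFun l x n| - fderiv ℝ (lyap l) x ((jordanBlock n).mulVec x) with hG
  have hGh : IsHomogeneous G (2 * ((n : ℝ) - 1) / n) := by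
    intro r hr x
    have h1 := (isHomogeneous_omegaFun_last hn l).abs r hr x
    have h2 := isHomogeneous_fderiv_partialLyap hn l le_rfl r hr x
    simp only at h1 h2
    simp only [hG]
    rw [lyap_eq_partialLyap, h1, h2]
    ring
  have hGc : Continuous G :=
    (continuous_const.mul (contDiff_omegaFun_last hn l).continuous.abs).sub
      (lyap_eq_partialLyap (n := n) l ▸ continuous_fderiv_partialLyap hn l le_rfl)
  have hGpos : ∀ x, x ≠ 0 → 0 < G x := by
    intro x hx
    have h1 := hneg x hx fun j hj => coord_of_gt x hj
    rw [hlast x, ← lyap_eq_partialLyap] at h1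
    simp only [hG]
    linarith
  obtain ⟨C, hC, hle⟩ := (isHomogeneous_lyap_rpow hn l).exists_le_mul hn hGh
    (continuous_lyap_rpow hn l) hGc hGpos
  refine ⟨l, fun i _ _ => hl i, C⁻¹, inv_pos.2 hC, fun x u => ?_⟩
  rw [map_add, map_smul, fderiv_lyap_lastVec hn l, smul_eq_mul, mul_add,
    mul_left_comm _ (l n), mul_sign_eq_abs]
  have key : C⁻¹ * lyap l x ^ (2 * ((n : ℝ) - 1) / (2 * n - 1)) ≤ G x := by
    rcases eq_or_ne x 0 with rfl | hx
    · simp [hG, lyap_zero hn, omegaFun_zero_left, Real.zero_rpow (lyap_exponent_pos hn).ne']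
    · rw [inv_mul_le_iff₀ hC]
      exact hle x hx
  simp only [hG] at key
  linarith

end Lyapunov

/-! ### The linear feedback -/

section LinearFeedback

variable {n : ℕ}

/-- The signed Pascal matrix `(-1)^{a+b} binom(a+b, a)`, with `a`, `b` counted down from `n - 1`. -/
def signedPascal (n : ℕ) : Matrix (Fin n) (Fin n) ℝ :=
  Matrix.of fun i j => (-1) ^ ((n - 1 - i) + (n - 1 - j)) *
    (((n - 1 - i) + (n - 1 - j)).choose (n - 1 - i) : ℝ)

/-- The lower triangular factor of `signedPascal`. -/
def signedPascalFactor (n : ℕ) : Matrix (Fin n) (Fin n) ℝ :=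
  Matrix.of fun i j => (-1) ^ (n - 1 - (i : ℕ)) * ((n - 1 - i).choose (n - 1 - j) : ℝ)

theorem sum_choose_mul_choose (a b : ℕ) {m : ℕ} (ha : a < m) :
    ∑ k ∈ Finset.range m, a.choose k * b.choose k = (a + b).choose a := by
  have h1 : ∑ k ∈ Finset.range m, a.choose k * b.choose k =
      ∑ k ∈ Finset.range (a + 1), a.choose k * b.choose k := by
    symm
    refine Finset.sum_subset (Finset.range_subset_range.2 ha) fun k _ hk => ?_
    rw [Nat.choose_eq_zero_of_lt, zero_mul]
    simp at hk
    omega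
  rw [h1, Nat.add_choose_eq, Finset.Nat.sum_antidiagonal_eq_sum_range_succ_mk,
    ← Finset.sum_range_reflect]
  refine Finset.sum_congr rfl fun k hk => ?_
  have := Finset.mem_range.1 hk
  rw [show a + 1 - 1 - k = a - k by omega, Nat.choose_symm (by omega)]

theorem signedPascal_eq_mul_transpose :
    signedPascal n = signedPascalFactor n * (signedPascalFactor n).transpose := by
  ext i j
  simp only [signedPascal, signedPascalFactor, Matrix.mul_apply, Matrix.transpose_apply,
    Matrix.of_apply]
  rw [← sum_choose_mul_choose (n - 1 - i) (n - 1 - j) (m := n) (by omega),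
    ← Finset.sum_range_reflect, ← Fin.sum_univ_eq_sum_range (fun k =>
      (n - 1 - (i : ℕ)).choose (n - 1 - k) * (n - 1 - (j : ℕ)).choose (n - 1 - k)) n]
  push_cast
  rw [Finset.mul_sum]
  refine Finset.sum_congr rfl fun k _ => ?_
  rw [pow_add]
  ring

theorem isUnit_signedPascalFactor : IsUnit (signedPascalFactor n) := by
  rw [Matrix.isUnit_iff_isUnit_det, Matrix.det_of_isUpperTriangular]
  · simp only [signedPascalFactor, Matrix.of_apply, Nat.choose_self, Nat.cast_one, mul_one,
      isUnit_iff_ne_zero]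
    exact Finset.prod_ne_zero_iff.2 fun _ _ => pow_ne_zero _ (by norm_num)
  · intro i j hij
    simp only [signedPascalFactor, Matrix.of_apply, id] at hij ⊢
    rw [Nat.choose_eq_zero_of_lt]
    · simp
    · have := j.isLt
      have : j.val < i.val := hij
      omega

theorem posDef_signedPascal : (signedPascal n).PosDef := by
  have h : IsUnit (signedPascalFactor n).transpose := by
    rw [Matrix.isUnit_transpose]; exact isUnit_signedPascalFactor
  rw [signedPascal_eq_mul_transpose]
  have := Matrix.PosDef.conjTranspose_mul_self (signedPascalFactor n).transpose
    (Matrix.mulVec_injective_of_isUnit h)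
  simpa [Matrix.conjTranspose_eq_transpose_of_trivial] using this

theorem signedPascal_apply (i j : Fin n) {a b : ℕ} (ha : n = i + 1 + a) (hb : n = j + 1 + b) :
    signedPascal n i j = (-1) ^ (a + b) * ((a + b).choose a : ℝ) := by
  simp only [signedPascal, Matrix.of_apply]
  rw [show n - 1 - (i : ℕ) = a by omega, show n - 1 - (j : ℕ) = b by omega]

/-- The Lyapunov equation `J Q + Q Jᵀ = e eᵀ - Q`, which is Pascal's rule. -/
theorem jordanBlock_mul_signedPascal :
    jordanBlock n * signedPascal n + signedPascal n * (jordanBlock n).transpose =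
      Matrix.vecMulVec (lastVec n) (lastVec n) - signedPascal n := by
  ext i j
  have h1 : (jordanBlock n * signedPascal n) i j = coord (fun k => signedPascal n k j) (i + 2) :=
    jordanBlock_mulVec_apply (fun k => signedPascal n k j) i
  have h2 : (signedPascal n * (jordanBlock n).transpose) i j =
      coord (signedPascal n i) (j + 2) := by
    rw [← jordanBlock_mulVec_apply, Matrix.mul_apply, Matrix.mulVec, dotProduct]
    exact Finset.sum_congr rfl fun k _ => mul_comm _ _
  rw [Matrix.add_apply, Matrix.sub_apply, Matrix.vecMulVec_apply, h1, h2]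
  obtain ⟨a, ha⟩ : ∃ a, n = i + 1 + a := ⟨n - (i + 1), by omega⟩
  obtain ⟨b, hb⟩ : ∃ b, n = j + 1 + b := ⟨n - (j + 1), by omega⟩
  rw [signedPascal_apply i j ha hb]
  have h3 : coord (fun k => signedPascal n k j) (i + 2) =
      if a = 0 then 0 else (-1) ^ (a - 1 + b) * ((a - 1 + b).choose (a - 1) : ℝ) := by
    split_ifs with h
    · exact coord_of_gt _ (by omega)
    · exact (coord_succ (fun k => signedPascal n k j) ⟨i + 1, by omega⟩).trans
        (signedPascal_apply _ _ (by simp only; omega) hb)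
  have h4 : coord (signedPascal n i) (j + 2) =
      if b = 0 then 0 else (-1) ^ (a + (b - 1)) * ((a + (b - 1)).choose a : ℝ) := by
    split_ifs with h
    · exact coord_of_gt _ (by omega)
    · exact (coord_succ (fun k => signedPascal n i k) ⟨j + 1, by omega⟩).trans
        (signedPascal_apply _ _ ha (by simp only; omega))
  have h5 : ∀ (k : Fin n) (c : ℕ), n = k + 1 + c → lastVec n k = if c = 0 then 1 else 0 := by
    intro k c hc
    unfold lastVec
    split_ifs <;> first | rfl | omega
  rw [h3, h4, h5 i a ha, h5 j b hb]
  rcases a with _ | a <;> rcases b with _ | b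
  · simp
  · simp [pow_succ]
  · simp [pow_succ]
  · simp only [Nat.add_sub_cancel, Nat.succ_ne_zero, if_false]
    rw [show a + 1 + (b + 1) = (a + b + 1) + 1 by ring, Nat.choose_succ_succ,
      show a + (b + 1) = a + b + 1 by ring, show a + 1 + b = a + b + 1 by ring]
    push_cast
    ring

theorem exists_le_dotProduct_mulVec {P : Matrix (Fin n) (Fin n) ℝ} (hP : P.PosDef) :
    ∃ c > 0, ∀ x : Fin n → ℝ, c * ‖x‖ ^ 2 ≤ x ⬝ᵥ P.mulVec x := by
  have hcont : Continuous fun x : Fin n → ℝ => x ⬝ᵥ P.mulVec x :=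
    continuous_id.dotProduct (Continuous.matrix_mulVec continuous_const continuous_id)
  obtain ⟨c, hc, hle⟩ := (isCompact_sphere (0 : Fin n → ℝ) 1).exists_forall_le'
    hcont.continuousOn (a := 0) fun x hx => by
      simpa using hP.dotProduct_mulVec_pos (x := x) (by rintro rfl; simp at hx)
  refine ⟨c, hc, fun x => ?_⟩
  rcases eq_or_ne x 0 with rfl | hx
  · simp
  · have h1 := hle (‖x‖⁻¹ • x) (by simp [norm_smul, hx])
    rw [Matrix.mulVec_smul, smul_dotProduct, dotProduct_smul, smul_eq_mul, smul_eq_mul,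
      ← mul_assoc, ← sq, inv_pow, le_inv_mul_iff₀ (by positivity)] at h1
    linarith

theorem dotProduct_self_le (x : Fin n → ℝ) : x ⬝ᵥ x ≤ n * ‖x‖ ^ 2 := by
  have : ∀ i ∈ Finset.univ, x i * x i ≤ ‖x‖ ^ 2 := fun i _ => by
    rw [← sq, ← sq_abs]
    exact pow_le_pow_left₀ (abs_nonneg _) (norm_le_pi_norm x i) 2
  simpa [dotProduct] using Finset.sum_le_card_nsmul _ _ _ this

theorem exists_robustLyapunovPair {g ρ₁ : ℝ} (hg : 0 < g) (hρ : 0 < ρ₁) (ρ₂ : ℝ) :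
    ∃ (K : Fin n → ℝ) (P : Matrix (Fin n) (Fin n) ℝ), RobustLyapunovPair n g ρ₁ ρ₂ K P := by
  set Q := signedPascal n with hQ
  set R := Q⁻¹ with hR
  have hRpos : R.PosDef := posDef_signedPascal.inv
  have hRt : R.transpose = R := hRpos.isHermitian
  have hdet : IsUnit Q.det := (Matrix.isUnit_iff_isUnit_det _).1 posDef_signedPascal.isUnit
  set w := R.mulVec (lastVec n) with hw
  have hvec : R * Matrix.vecMulVec (lastVec n) (lastVec n) * R = Matrix.vecMulVec w w := by
    rw [Matrix.mul_vecMulVec, Matrix.vecMulVec_mul, hw, ← Matrix.mulVec_transpose, hRt]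
  have hlyap : (jordanBlock n).transpose * R + R * jordanBlock n = Matrix.vecMulVec w w - R := by
    have h := congrArg (fun X => R * X * R) (jordanBlock_mul_signedPascal (n := n))
    simp only [mul_add, add_mul, mul_sub, sub_mul] at h
    rw [← hQ, hvec, ← mul_assoc R Q, Matrix.nonsing_inv_mul _ hdet, one_mul, one_mul,
      mul_assoc R (_ * Q), mul_assoc _ Q R, Matrix.mul_nonsing_inv _ hdet, mul_one, add_comm] at h
    exact h
  obtain ⟨c, hc, hle⟩ := exists_le_dotProduct_mulVec hRpos
  set s := (n + 1) / c with hs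
  have hs0 : 0 < s := by positivity
  refine ⟨(1 / (2 * ρ₁ * g)) • w, s • R, hRpos.smul hs0, fun ρ hρmem => ?_⟩
  have hkey : (-(1 : Matrix (Fin n) (Fin n) ℝ) -
      ((jordanBlock n - (ρ * g) • Matrix.vecMulVec (lastVec n)
          ((1 / (2 * ρ₁ * g)) • w)).transpose * (s • R) +
        (s • R) * (jordanBlock n - (ρ * g) • Matrix.vecMulVec (lastVec n)
          ((1 / (2 * ρ₁ * g)) • w)))) =
      (s • R - 1) + (s * (ρ / ρ₁ - 1)) • Matrix.vecMulVec w w := by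
    have e1 : R * Matrix.vecMulVec (lastVec n) w = Matrix.vecMulVec w w := by
      rw [Matrix.mul_vecMulVec]
    have e2 : Matrix.vecMulVec w (lastVec n) * R = Matrix.vecMulVec w w := by
      rw [Matrix.vecMulVec_mul, ← Matrix.mulVec_transpose, hRt]
    rw [Matrix.transpose_sub, Matrix.transpose_smul, Matrix.vecMulVec_smul,
      Matrix.transpose_smul, Matrix.transpose_vecMulVec, sub_mul, mul_sub, Matrix.mul_smul,
      Matrix.smul_mul, Matrix.smul_mul, Matrix.smul_mul, Matrix.mul_smul, Matrix.mul_smul,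
      Matrix.mul_smul, Matrix.smul_mul, e1, e2]
    have e4 : (jordanBlock n).transpose * R = Matrix.vecMulVec w w - R - R * jordanBlock n := by
      rw [← hlyap]; abel
    rw [e4]
    simp only [smul_smul]
    ext i j
    simp only [Matrix.sub_apply, Matrix.add_apply, Matrix.smul_apply, Matrix.neg_apply,
      smul_eq_mul]
    field_simp
    ring
  rw [hkey]
  refine Matrix.PosSemidef.add (.of_dotProduct_mulVec_nonneg ?_ fun x => ?_) ?_
  · refine Matrix.IsHermitian.sub ?_ Matrix.isHermitian_one
    exact (hRpos.smul hs0).isHermitian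
  · rw [Matrix.sub_mulVec, Matrix.one_mulVec, Matrix.smul_mulVec, dotProduct_sub,
      dotProduct_smul, star_trivial, smul_eq_mul, sub_nonneg]
    refine (dotProduct_self_le x).trans ?_
    have h1 := mul_le_mul_of_nonneg_left (hle x) hs0.le
    have h2 : s * (c * ‖x‖ ^ 2) = (n + 1) * ‖x‖ ^ 2 := by rw [hs]; field_simp
    nlinarith [sq_nonneg ‖x‖]
  · refine Matrix.PosSemidef.smul ?_ (mul_nonneg hs0.le ?_)
    · simpa using Matrix.posSemidef_vecMulVec_self_star w
    · rw [sub_nonneg, one_le_div hρ]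
      exact hρmem.1

end LinearFeedback

/-! ### Scalar dissipation inequalities -/

section Scalar

theorem _root_.LocallyLipschitz.comp_absolutelyContinuousOnInterval {X Y : Type*}
    [SeminormedAddCommGroup X] [PseudoMetricSpace Y] {f : X → Y} {x : ℝ → X} {a b : ℝ}
    (hf : LocallyLipschitz f) (hx : AbsolutelyContinuousOnInterval x a b) :
    AbsolutelyContinuousOnInterval (fun t => f (x t)) a b := by
  have hcomp : IsCompact (image x (uIcc a b)) :=
    isCompact_uIcc.image_of_continuousOn hx.continuousOn
  obtain ⟨K, hK⟩ := LocallyLipschitzOn.exists_lipschitzOnWith_of_compact hcomp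
    hf.locallyLipschitzOn
  have h0 := Tendsto.const_mul (K : ℝ) hx
  rw [mul_zero] at h0
  refine squeeze_zero' (Eventually.of_forall fun E => Finset.sum_nonneg fun _ _ => dist_nonneg)
    ?_ h0
  filter_upwards [mem_inf_of_right (mem_principal_self _)] with E hE
  rw [Finset.mul_sum]
  exact Finset.sum_le_sum fun i hi => hK.dist_le_mul _ (mem_image_of_mem x (hE.1 i hi).1) _
    (mem_image_of_mem x (hE.1 i hi).2)

variable {ψ u d : ℝ → ℝ} {c C t : ℝ}

/-- `u` is absolutely continuous on `[0, t]`, nonnegative, and `u' ≤ -c ψ(u) + C |d|` almost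
everywhere. -/
structure Dissipates (ψ u d : ℝ → ℝ) (c C t : ℝ) : Prop where
  absolutelyContinuous : AbsolutelyContinuousOnInterval u 0 t
  nonneg : ∀ s, 0 ≤ u s
  integrable : IntegrableOn d (Icc 0 t)
  deriv_le : ∀ᵐ s, s ∈ Icc 0 t → ∃ u', HasDerivAt u u' s ∧ u' ≤ -c * ψ (u s) + C * |d s|

theorem Dissipates.integral_le (h : Dissipates ψ u d c C t) (hψ : Continuous ψ)
    {χ : ℝ → ℝ} (hχ : Continuous χ) (hχ0 : ∀ r, 0 ≤ χ r) {a b : ℝ} (ha : 0 ≤ a) (hab : a ≤ b)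
    (hbt : b ≤ t) :
    IntervalIntegrable (fun s => χ (u s) * (-c * ψ (u s) + C * |d s|)) volume a b ∧
    (∫ r in 0..u b, χ r) - ∫ r in 0..u a, χ r ≤
      ∫ s in a..b, χ (u s) * (-c * ψ (u s) + C * |d s|) := by
  set X : ℝ → ℝ := fun r => ∫ v in 0..r, χ v with hX
  have hXd : ∀ r, HasDerivAt X (χ r) r := fun r =>
    intervalIntegral.integral_hasDerivAt_right (hχ.intervalIntegrable _ _)
      hχ.stronglyMeasurable.stronglyMeasurableAtFilter hχ.continuousAt
  have hXc : ContDiff ℝ 1 X := by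
    rw [contDiff_one_iff_deriv]
    refine ⟨fun r => (hXd r).differentiableAt, ?_⟩
    rwa [show deriv X = χ from funext fun r => (hXd r).deriv]
  have hsub : uIcc a b ⊆ uIcc 0 t := by
    rw [uIcc_of_le hab, uIcc_of_le (ha.trans (hab.trans hbt))]
    exact Icc_subset_Icc ha hbt
  have hu : AbsolutelyContinuousOnInterval u a b := h.absolutelyContinuous.mono hsub
  have hXu := hXc.locallyLipschitz.comp_absolutelyContinuousOnInterval hu
  have hd : IntervalIntegrable d volume a b :=
    (h.integrable.mono_set (by rw [uIcc_of_le hab]; exact Icc_subset_Icc ha hbt)).intervalIntegrable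
  have hint : IntervalIntegrable (fun s => χ (u s) * (-c * ψ (u s) + C * |d s|)) volume a b := by
    refine IntervalIntegrable.continuousOn_mul (IntervalIntegrable.add ?_ (hd.abs.const_mul C))
      (hχ.comp_continuousOn hu.continuousOn)
    exact (continuousOn_const.mul (hψ.comp_continuousOn hu.continuousOn)).intervalIntegrable
  refine ⟨hint, ?_⟩
  rw [← hXu.integral_deriv_eq_sub]
  refine intervalIntegral.integral_mono_ae_restrict hab hXu.intervalIntegrable_deriv hint ?_
  rw [EventuallyLE, ae_restrict_iff' measurableSet_Icc]
  filter_upwards [h.deriv_le] with s hs hsab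
  obtain ⟨u', hu', hle⟩ := hs ⟨ha.trans hsab.1, hsab.2.trans hbt⟩
  have := ((hXd (u s)).comp s hu').deriv
  simp only [Function.comp_def] at this
  rw [this]
  exact mul_le_mul_of_nonneg_left hle (hχ0 _)

/-- Sublevel sets of `ψ` at levels above `C D / c` are invariant if `|d| ≤ D`. -/
theorem Dissipates.barrier (h : Dissipates ψ u d c C t) (hψ : Continuous ψ) (hmono : Monotone ψ)
    (hψ0 : ψ 0 = 0) (hC : 0 ≤ C) {D m : ℝ} (hm0 : 0 ≤ m) (hm : C * D ≤ c * m)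
    (hc : 0 < c)
    (hD : ∀ᵐ s, s ∈ Icc 0 t → |d s| ≤ D) {a b : ℝ} (ha : 0 ≤ a) (hab : a ≤ b) (hbt : b ≤ t)
    (hua : ψ (u a) ≤ m) : ψ (u b) ≤ m := by
  set χ : ℝ → ℝ := fun r => max (ψ r - m) 0 with hχ
  have hχc : Continuous χ := (hψ.sub continuous_const).max continuous_const
  have hχ0 : ∀ r, 0 ≤ χ r := fun r => le_max_right _ _
  obtain ⟨-, hle⟩ := h.integral_le hψ hχc hχ0 ha hab hbt
  have h1 : ∫ r in 0..u a, χ r = 0 := by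
    refine intervalIntegral.integral_zero_ae (Eventually.of_forall fun r hr => ?_)
    rw [uIoc_of_le (h.nonneg a)] at hr
    exact max_eq_right (by linarith [hmono hr.2])
  have h2 : ∫ s in a..b, χ (u s) * (-c * ψ (u s) + C * |d s|) ≤ 0 := by
    rw [intervalIntegral.integral_of_le hab]
    refine integral_nonpos_of_ae ?_
    rw [EventuallyLE, ae_restrict_iff' measurableSet_Ioc]
    filter_upwards [hD] with s hs hsab
    have h3 := mul_le_mul_of_nonneg_left (hs ⟨ha.trans hsab.1.le, hsab.2.trans hbt⟩) hC
    rcases le_total (ψ (u s)) m with h4 | h4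
    · simp [hχ, h4]
    · refine mul_nonpos_of_nonneg_of_nonpos (hχ0 _) ?_
      nlinarith
  by_contra hcon
  rw [not_le] at hcon
  have hub : 0 < u b := by
    refine (h.nonneg b).lt_of_ne fun h0 => ?_
    rw [← h0, hψ0] at hcon
    linarith
  have h5 : 0 < ∫ r in 0..u b, χ r :=
    intervalIntegral.integral_pos hub hχc.continuousOn (fun r _ => hχ0 r)
      ⟨u b, right_mem_Icc.2 hub.le, lt_max_of_lt_left (by linarith)⟩
  linarith

theorem rpow_sub_one_mul_le {c C ψ d q : ℝ} (hc : 0 < c) (hC : 0 < C) (hψ : 0 ≤ ψ) (hd : 0 ≤ d)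
    (hq : 1 ≤ q) : ψ ^ (q - 1) * (-c * ψ + C * d) ≤
      -(c / 2) * ψ ^ q + c / 2 * ((2 * C / c) ^ q * d ^ q) := by
  have hq' : q - 1 + 1 = q := by ring
  have e1 : ∀ y : ℝ, 0 ≤ y → y ^ q = y ^ (q - 1) * y := fun y hy => by
    conv_lhs => rw [← hq']
    rcases hy.eq_or_lt with rfl | hy
    · rw [mul_zero, Real.zero_rpow (by linarith)]
    · exact Real.rpow_add_one hy.ne' _
  have hK : 0 < 2 * C / c := by positivity
  have e2 : (2 * C / c) ^ q * d ^ q = (2 * C / c * d) ^ (q - 1) * (2 * C / c * d) := by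
    rw [← Real.mul_rpow hK.le hd, e1 _ (by positivity)]
  rw [e2, e1 ψ hψ]
  have hp : 0 ≤ ψ ^ (q - 1) := by positivity
  rcases le_total ψ (2 * C / c * d) with h | h
  · have h1 : ψ ^ (q - 1) ≤ (2 * C / c * d) ^ (q - 1) :=
      Real.rpow_le_rpow hψ h (by linarith)
    have h2 : C * d = c / 2 * (2 * C / c * d) := by field_simp
    have h3 : 0 ≤ 2 * C / c * d := by positivity
    have h4 := mul_le_mul_of_nonneg_right h1 h3
    have h5 := mul_le_mul_of_nonneg_left h4 (by positivity : 0 ≤ c / 2)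
    rw [h2]
    have h6 : 0 ≤ ψ ^ (q - 1) * (c * ψ) := by positivity
    nlinarith
  · have h2 : C * d ≤ c / 2 * ψ := by
      have := mul_le_mul_of_nonneg_left h (by positivity : 0 ≤ c / 2)
      have e : c / 2 * (2 * C / c * d) = C * d := by field_simp
      linarith
    have h3 := mul_le_mul_of_nonneg_left h2 hp
    have h4 : 0 ≤ c / 2 * ((2 * C / c * d) ^ (q - 1) * (2 * C / c * d)) := by positivity
    nlinarith

theorem Dissipates.integral_rpow_le (h : Dissipates ψ u d c C t) (hψ : Continuous ψ)
    (hψ0 : ∀ r, 0 ≤ ψ r) (hc : 0 < c) (hC : 0 < C) {q : ℝ} (hq : 1 ≤ q) (ht : 0 ≤ t)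
    (hu0 : u 0 = 0) (hd : IntegrableOn (fun s => |d s| ^ q) (Icc 0 t)) :
    ∫ s in Icc 0 t, ψ (u s) ^ q ≤ (2 * C / c) ^ q * ∫ s in Icc 0 t, |d s| ^ q := by
  have hχc : Continuous fun r => ψ r ^ (q - 1) :=
    hψ.rpow_const fun _ => Or.inr (by linarith)
  obtain ⟨hint, hle⟩ := h.integral_le hψ hχc (fun r => Real.rpow_nonneg (hψ0 r) _) le_rfl ht le_rfl
  have h1 : 0 ≤ ∫ r in 0..u t, ψ r ^ (q - 1) :=
    intervalIntegral.integral_nonneg (h.nonneg t) fun r _ => Real.rpow_nonneg (hψ0 r) _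
  rw [hu0, intervalIntegral.integral_same, sub_zero] at hle
  have hucont : ContinuousOn u (Icc 0 t) := by
    simpa [uIcc_of_le ht] using h.absolutelyContinuous.continuousOn
  have hψint : IntegrableOn (fun s => ψ (u s) ^ q) (Icc 0 t) :=
    ((hψ.comp_continuousOn hucont).rpow_const fun _ _ => Or.inr (by linarith)).integrableOn_Icc
  rw [intervalIntegral.integral_of_le ht, ← integral_Icc_eq_integral_Ioc] at hle
  rw [intervalIntegrable_iff_integrableOn_Icc_of_le ht] at hint
  have h2 : ∫ s in Icc 0 t, ψ (u s) ^ (q - 1) * (-c * ψ (u s) + C * |d s|) ≤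
      ∫ s in Icc 0 t, (-(c / 2) * ψ (u s) ^ q + c / 2 * ((2 * C / c) ^ q * |d s| ^ q)) := by
    refine integral_mono hint ((hψint.const_mul _).add ((hd.const_mul _).const_mul _)) fun s => ?_
    exact rpow_sub_one_mul_le hc hC (hψ0 _) (abs_nonneg _) hq
  rw [integral_add (hψint.const_mul _) ((hd.const_mul _).const_mul _), integral_const_mul,
    integral_const_mul, integral_const_mul] at h2
  have h3 : 0 ≤ c / 2 * ((2 * C / c) ^ q * (∫ s in Icc 0 t, |d s| ^ q) -
      ∫ s in Icc 0 t, ψ (u s) ^ q) := by linarith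
  have h4 := nonneg_of_mul_nonneg_right h3 (by positivity)
  linarith

end Scalar

/-! ### Finite gain from a Lyapunov function -/

section FiniteGain

theorem Icc_subset_timeInterval {T : ℝ≥0∞} {t : ℝ} (ht : t ∈ timeInterval T) :
    Icc 0 t ⊆ timeInterval T := fun _ hs =>
  ⟨hs.1, (ENNReal.ofReal_le_ofReal hs.2).trans_lt ht.2⟩

theorem timeInterval_eq_iUnion (T : ℝ≥0∞) :
    timeInterval T = ⋃ q : {q : ℚ // (q : ℝ) ∈ timeInterval T}, Icc 0 ((q : ℚ) : ℝ) := by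
  apply Subset.antisymm
  · intro t ht
    obtain ⟨q, hq0, h1, h2⟩ := ENNReal.lt_iff_exists_rat_btwn.1 ht.2
    have hq : (0 : ℝ) ≤ q := by exact_mod_cast hq0
    refine mem_iUnion.2 ⟨⟨q, hq, h2⟩, ht.1, ?_⟩
    by_contra hcon
    exact absurd h1 (not_lt.2 (ENNReal.ofReal_le_ofReal (not_le.1 hcon).le))
  · exact iUnion_subset fun q => Icc_subset_timeInterval q.2

theorem measurableSet_timeInterval (T : ℝ≥0∞) : MeasurableSet (timeInterval T) := by
  rw [timeInterval_eq_iUnion]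
  exact MeasurableSet.iUnion fun _ => measurableSet_Icc

theorem setLIntegral_timeInterval_le {T : ℝ≥0∞} {f : ℝ → ℝ≥0∞} {B : ℝ≥0∞}
    (h : ∀ t ∈ timeInterval T, ∫⁻ s in Icc 0 t, f s ≤ B) : ∫⁻ s in timeInterval T, f s ≤ B := by
  rw [timeInterval_eq_iUnion, setLIntegral_iUnion_of_directed]
  · exact iSup_le fun q => h _ q.2
  · intro p q
    rcases le_total (p : ℚ) q with hpq | hpq
    · exact ⟨q, Icc_subset_Icc_right (by exact_mod_cast hpq), Subset.rfl⟩
    · exact ⟨p, Subset.rfl, Icc_subset_Icc_right (by exact_mod_cast hpq)⟩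

/-- A Lyapunov function `U` with `U' ≤ -c ψ(U) + C |d|` along trajectories, where `ψ(U)` dominates
the norm of the state, gives finite gain in every `L_p`. -/
theorem isFiniteGainLpStabilizing_of_lyapunov {n : ℕ} {σ : ℝ → ℝ} {f : (Fin n → ℝ) → ℝ}
    {U : (Fin n → ℝ) → ℝ} {ψ : ℝ → ℝ} {c C M : ℝ} (hU : LocallyLipschitz U) (hU0 : U 0 = 0)
    (hUnonneg : ∀ x, 0 ≤ U x) (hψ : Continuous ψ) (hmono : Monotone ψ) (hψ0 : ψ 0 = 0)
    (hψnonneg : ∀ r, 0 ≤ ψ r) (hc : 0 < c) (hC : 0 < C) (hM : 0 < M)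
    (hx : ∀ x, ‖WithLp.toLp 2 x‖ ≤ M * ψ (U x))
    (hder : ∀ (d : ℝ → ℝ) (T : ℝ≥0∞) (x : ℝ → Fin n → ℝ), IsTrajectory n σ f d T x →
      ∀ᵐ t ∂(volume.restrict (timeInterval T)),
        ∃ u', HasDerivAt (fun t => U (x t)) u' t ∧ u' ≤ -c * ψ (U (x t)) + C * |d t|)
    (p : ℝ≥0∞) (hp : 1 ≤ p) : IsFiniteGainLpStabilizing n σ f p := by
  have hγ : 0 < M * (2 * C / c) := by positivity
  refine ⟨M * (2 * C / c), hγ, fun d hd => ?_⟩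
  have hdiss : ∀ (T : ℝ≥0∞) (x : ℝ → Fin n → ℝ), IsTrajectory n σ f d T x →
      ∀ t ∈ timeInterval T, Dissipates ψ (fun s => U (x s)) d c C t := by
    intro T x hT t ht
    refine ⟨hU.comp_absolutelyContinuousOnInterval (hT.1 t ht), fun s => hUnonneg _, ?_, ?_⟩
    · exact (hd.mono_measure (Measure.restrict_mono Icc_subset_Ici_self le_rfl)).integrable hp
    · have h1 := hder d T x hT
      rw [ae_restrict_iff' (measurableSet_timeInterval T)] at h1
      filter_upwards [h1] with s hs hst using hs (Icc_subset_timeInterval ht hst)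
  have hp0 : p ≠ 0 := (zero_lt_one.trans_le hp).ne'
  rcases eq_or_ne p ∞ with rfl | hptop
  · set D := (eLpNorm d ∞ (volume.restrict (Ici 0))).toReal with hD
    have hDtop : eLpNorm d ∞ (volume.restrict (Ici 0)) ≠ ∞ := hd.2.ne
    have hD0 : 0 ≤ D := ENNReal.toReal_nonneg
    have hdD : ∀ t : ℝ, ∀ᵐ s, s ∈ Icc 0 t → |d s| ≤ D := by
      intro t
      have h1 := ae_le_eLpNormEssSup (f := d) (μ := volume.restrict (Ici 0))
      rw [ae_restrict_iff' measurableSet_Ici] at h1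
      filter_upwards [h1] with s hs hst
      have h2 := hs hst.1
      rw [← eLpNorm_exponent_top] at h2
      have h3 := ENNReal.toReal_mono hDtop h2
      rwa [toReal_enorm] at h3
    have hgain : ENNReal.ofReal (M * (2 * C / c)) * eLpNorm d ∞ (volume.restrict (Ici 0)) =
        ENNReal.ofReal (M * (2 * C / c) * D) := by
      rw [ENNReal.ofReal_mul hγ.le, hD, ENNReal.ofReal_toReal hDtop]
    have hm : C * D ≤ c * (C * D / c) := by rw [mul_div_cancel₀ _ hc.ne']
    have hm0 : 0 ≤ C * D / c := by positivity
    rw [hgain]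
    refine ⟨fun T x hT hx0 => ?_, fun _ x hT => ?_⟩
    · rw [eLpNorm_exponent_top]
      refine essSup_le_of_ae_le _ ?_
      rw [EventuallyLE, ae_restrict_iff' (measurableSet_timeInterval T)]
      refine Eventually.of_forall fun t ht => ?_
      have h1 := (hdiss T x hT t ht).barrier hψ hmono hψ0 hC.le hm0 hm hc (hdD t) le_rfl ht.1
        le_rfl (by simpa [hx0, hU0, hψ0] using hm0)
      rw [← ofReal_norm]
      refine ENNReal.ofReal_le_ofReal ((hx _).trans ?_)
      have h2 := mul_le_mul_of_nonneg_left h1 hM.le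
      have h3 : M * (2 * C / c) * D = M * (C * D / c) + M * (C * D / c) := by ring
      have h4 : 0 ≤ M * (C * D / c) := by positivity
      linarith
    · have hev : ∀ ε > 0, ∀ᶠ t in atTop, ψ (U (x t)) ≤ C * D / c + ε := by
        intro ε hε
        have hdis : ∀ t ≥ 0, Dissipates ψ (fun s => U (x s)) d c C t := fun t ht =>
          hdiss ∞ x hT t ⟨ht, ENNReal.ofReal_lt_top⟩
        by_cases hex : ∃ a ≥ 0, ψ (U (x a)) ≤ C * D / c + ε
        · obtain ⟨a, ha, hle⟩ := hex
          filter_upwards [eventually_ge_atTop a] with t hat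
          exact (hdis t (ha.le.trans hat)).barrier hψ hmono hψ0 hC.le (by positivity)
            (hm.trans (by gcongr; linarith)) hc (hdD t) ha hat le_rfl hle
        · push Not at hex
          exfalso
          set t := U (x 0) / (c * ε) + 1 with ht
          have ht0 : 0 < t := by have := hUnonneg (x 0); positivity
          obtain ⟨-, h1⟩ := (hdis t ht0.le).integral_le hψ (χ := fun _ => 1) continuous_const
            (fun _ => zero_le_one) le_rfl ht0.le le_rfl
          have h2 : ∫ s in (0 : ℝ)..t, 1 * (-c * ψ (U (x s)) + C * |d s|) ≤
              ∫ s in (0 : ℝ)..t, -(c * ε) := by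
            refine intervalIntegral.integral_mono_ae_restrict ht0.le ?_ (by simp) ?_
            · exact ((hdis t ht0.le).integral_le hψ (χ := fun _ => 1) continuous_const
                (fun _ => zero_le_one) le_rfl ht0.le le_rfl).1
            · rw [EventuallyLE, ae_restrict_iff' measurableSet_Icc]
              filter_upwards [hdD t] with s hs hst
              have h3 := mul_le_mul_of_nonneg_left (hs hst) hC.le
              have h4 := mul_lt_mul_of_pos_left (hex s hst.1) hc
              rw [mul_add, mul_div_cancel₀ _ hc.ne'] at h4
              linarith
          have h5 : (U (x 0) / (c * ε) + 1) * (c * ε) = U (x 0) + c * ε := by field_simp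
          simp only [intervalIntegral.integral_const, sub_zero, smul_eq_mul, mul_one] at h1 h2
          rw [← ht] at h5
          have := hUnonneg (x t)
          have : 0 < c * ε := by positivity
          nlinarith
      refine le_of_forall_gt_imp_ge_of_dense fun B hB => ?_
      rcases eq_or_ne B ∞ with rfl | hBtop
      · exact le_top
      have hB' : M * (2 * C / c) * D < B.toReal := by
        rwa [← ENNReal.ofReal_lt_iff_lt_toReal (by positivity) hBtop]
      refine limsup_le_of_le (by isBoundedDefault) ?_
      filter_upwards [hev ((B.toReal - M * (2 * C / c) * D) / M) (div_pos (by linarith) hM)]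
        with t ht
      rw [← ofReal_norm, ENNReal.ofReal_le_iff_le_toReal hBtop]
      refine (hx _).trans ?_
      have h2 := mul_le_mul_of_nonneg_left ht hM.le
      rw [mul_add, mul_div_cancel₀ _ hM.ne'] at h2
      have h3 : M * (2 * C / c) * D = M * (C * D / c) + M * (C * D / c) := by ring
      have h4 : 0 ≤ M * (C * D / c) := by positivity
      linarith
  · refine ⟨fun T x hT hx0 => ?_, fun h => absurd h hptop⟩
    set q := p.toReal with hq
    have hq1 : 1 ≤ q := by
      rw [hq, ← ENNReal.toReal_one]
      exact ENNReal.toReal_mono hptop hp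
    have hq0 : 0 < q := by linarith
    have henorm : ∀ {E : Type} [NormedAddCommGroup E] (y : E),
        ‖y‖ₑ ^ q = ENNReal.ofReal (‖y‖ ^ q) :=
      fun y => by rw [← ofReal_norm, ENNReal.ofReal_rpow_of_nonneg (norm_nonneg _) hq0.le]
    have key : ∫⁻ s in timeInterval T, ‖WithLp.toLp 2 (x s)‖ₑ ^ q ≤
        ENNReal.ofReal (M * (2 * C / c)) ^ q * ∫⁻ s in Ici 0, ‖d s‖ₑ ^ q := by
      refine setLIntegral_timeInterval_le fun t ht => ?_
      have hdis := hdiss T x hT t ht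
      have hdt := hd.mono_measure
        (Measure.restrict_mono (Icc_subset_Ici_self : Icc 0 t ⊆ Ici 0) le_rfl)
      have hdint : IntegrableOn (fun s => |d s| ^ q) (Icc 0 t) :=
        hdt.integrable_norm_rpow hp0 hptop
      have h1 := hdis.integral_rpow_le hψ hψnonneg hc hC hq1 ht.1 (by simp [hx0, hU0]) hdint
      have hucont : ContinuousOn (fun s => U (x s)) (Icc 0 t) := by
        simpa [uIcc_of_le ht.1] using hdis.absolutelyContinuous.continuousOn
      have hψint : IntegrableOn (fun s => ψ (U (x s)) ^ q) (Icc 0 t) :=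
        ((hψ.comp_continuousOn hucont).rpow_const fun _ _ => Or.inr hq0.le).integrableOn_Icc
      calc ∫⁻ s in Icc 0 t, ‖WithLp.toLp 2 (x s)‖ₑ ^ q
          ≤ ∫⁻ s in Icc 0 t, ENNReal.ofReal (M ^ q) * ENNReal.ofReal (ψ (U (x s)) ^ q) := by
            refine lintegral_mono fun s => ?_
            rw [henorm, ← ENNReal.ofReal_mul (by positivity),
              ← Real.mul_rpow hM.le (hψnonneg _)]
            exact ENNReal.ofReal_le_ofReal (Real.rpow_le_rpow (norm_nonneg _) (hx _) hq0.le)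
        _ = ENNReal.ofReal (M ^ q) * ENNReal.ofReal (∫ s in Icc 0 t, ψ (U (x s)) ^ q) := by
            rw [lintegral_const_mul' _ _ ENNReal.ofReal_ne_top,
              ofReal_integral_eq_lintegral_ofReal hψint
                (Eventually.of_forall fun s => Real.rpow_nonneg (hψnonneg _) _)]
        _ ≤ ENNReal.ofReal (M ^ q) *
              ENNReal.ofReal ((2 * C / c) ^ q * ∫ s in Icc 0 t, |d s| ^ q) := by
            gcongr
        _ = ENNReal.ofReal (M * (2 * C / c)) ^ q * ∫⁻ s in Icc 0 t, ‖d s‖ₑ ^ q := by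
            rw [ENNReal.ofReal_mul (by positivity), ← mul_assoc,
              ← ENNReal.ofReal_mul (by positivity), ← Real.mul_rpow hM.le (by positivity),
              ENNReal.ofReal_rpow_of_nonneg hγ.le hq0.le,
              ofReal_integral_eq_lintegral_ofReal hdint
                (Eventually.of_forall fun s => Real.rpow_nonneg (abs_nonneg _) _)]
            simp only [henorm, Real.norm_eq_abs]
        _ ≤ ENNReal.ofReal (M * (2 * C / c)) ^ q * ∫⁻ s in Ici 0, ‖d s‖ₑ ^ q := by
            gcongr
            exact Icc_subset_Ici_self
    rw [eLpNorm_eq_lintegral_rpow_enorm_toReal hp0 hptop,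
      eLpNorm_eq_lintegral_rpow_enorm_toReal hp0 hptop, ← hq]
    calc (∫⁻ s in timeInterval T, ‖WithLp.toLp 2 (x s)‖ₑ ^ q) ^ (1 / q)
        ≤ (ENNReal.ofReal (M * (2 * C / c)) ^ q * ∫⁻ s in Ici 0, ‖d s‖ₑ ^ q) ^ (1 / q) :=
          ENNReal.rpow_le_rpow key (by positivity)
      _ = _ := by
          rw [ENNReal.mul_rpow_of_nonneg _ _ (by positivity), ← ENNReal.rpow_mul,
            mul_one_div_cancel hq0.ne', ENNReal.rpow_one]

end FiniteGain

/-! ### Saturations -/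

section Saturation

/-- The properties of an `S`-function apart from the rate of convergence at infinity. They are
invariant under the reflection `s ↦ -σ(-s)`. -/
structure IsSaturation (σ : ℝ → ℝ) (a₁ a₂ b₁ b₂ σinf : ℝ) : Prop where
  locallyLipschitz : LocallyLipschitz σ
  a₁_pos : 0 < a₁
  b₁_pos : 0 < b₁
  b₂_pos : 0 < b₂
  a_le : a₁ ≤ a₂
  ratio_le : a₁ / b₁ ≤ a₂ / b₂
  sector_lower : ∀ x, a₁ * x * stdSat (x / b₁) ≤ x * σ x
  sector_upper : ∀ x, x * σ x ≤ a₂ * x * stdSat (x / b₂)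
  tendsto_atTop : Tendsto σ atTop (𝓝 σinf)
  tendsto_atBot : Tendsto σ atBot (𝓝 (-σinf))

variable {σ : ℝ → ℝ} {a₁ a₂ b₁ b₂ σinf : ℝ}

theorem IsSFunction.isSaturation (h : IsSFunction σ a₁ a₂ b₁ b₂ σinf) :
    IsSaturation σ a₁ a₂ b₁ b₂ σinf :=
  ⟨h.locallyLipschitz, h.a₁_pos, h.b₁_pos, h.b₂_pos, h.a_le, h.ratio_le, h.sector_lower,
    h.sector_upper, h.tendsto_atTop, h.tendsto_atBot⟩

theorem stdSat_neg (x : ℝ) : stdSat (-x) = -stdSat x := by simp [stdSat, neg_div]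

theorem mul_stdSat_nonneg {b : ℝ} (hb : 0 < b) (x : ℝ) : 0 ≤ x * stdSat (x / b) := by
  have : x * stdSat (x / b) = x ^ 2 / (b * max 1 |x / b|) := by
    rw [stdSat, div_div, mul_div_assoc', sq]
  rw [this]
  have : 0 < max 1 |x / b| := lt_max_of_lt_left one_pos
  positivity

theorem abs_stdSat_le_one (x : ℝ) : |stdSat x| ≤ 1 := by
  have : 0 < max 1 |x| := lt_max_of_lt_left one_pos
  rw [stdSat, abs_div, abs_of_pos this, div_le_one this]
  exact le_max_right _ _

theorem stdSat_of_abs_le {x : ℝ} (h : |x| ≤ 1) : stdSat x = x := by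
  rw [stdSat, max_eq_left h, div_one]

theorem stdSat_of_one_le {x : ℝ} (h : 1 ≤ x) : stdSat x = 1 := by
  have : |x| = x := abs_of_nonneg (by linarith)
  rw [stdSat, this, max_eq_right h, div_self (by linarith)]

theorem IsSaturation.reflect (h : IsSaturation σ a₁ a₂ b₁ b₂ σinf) :
    IsSaturation (fun s => -σ (-s)) a₁ a₂ b₁ b₂ σinf where
  locallyLipschitz := by
    have h1 : LocallyLipschitz fun s : ℝ => σ (-s) :=
      h.locallyLipschitz.comp LipschitzWith.id.neg.locallyLipschitz
    exact LipschitzWith.id.neg.locallyLipschitz.comp h1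
  a₁_pos := h.a₁_pos
  b₁_pos := h.b₁_pos
  b₂_pos := h.b₂_pos
  a_le := h.a_le
  ratio_le := h.ratio_le
  sector_lower x := by
    have := h.sector_lower (-x)
    rw [neg_div, stdSat_neg] at this
    linarith
  sector_upper x := by
    have := h.sector_upper (-x)
    rw [neg_div, stdSat_neg] at this
    linarith
  tendsto_atTop := by simpa using (h.tendsto_atBot.comp tendsto_neg_atTop_atBot).neg
  tendsto_atBot := (h.tendsto_atTop.comp tendsto_neg_atBot_atTop).neg

theorem IsSaturation.mul_nonneg (h : IsSaturation σ a₁ a₂ b₁ b₂ σinf) (x : ℝ) : 0 ≤ x * σ x := by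
  refine le_trans ?_ (h.sector_lower x)
  rw [mul_assoc]
  exact _root_.mul_nonneg h.a₁_pos.le (mul_stdSat_nonneg h.b₁_pos x)

theorem IsSaturation.limit_pos (h : IsSaturation σ a₁ a₂ b₁ b₂ σinf) : 0 < σinf := by
  refine h.a₁_pos.trans_le (ge_of_tendsto h.tendsto_atTop ?_)
  filter_upwards [eventually_ge_atTop b₁] with x hx
  have h1 := h.sector_lower x
  have hx0 : 0 < x := h.b₁_pos.trans_le hx
  rw [stdSat_of_one_le ((one_le_div h.b₁_pos).2 hx), mul_one, mul_comm] at h1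
  exact le_of_mul_le_mul_left h1 hx0

theorem IsSaturation.map_zero (h : IsSaturation σ a₁ a₂ b₁ b₂ σinf) : σ 0 = 0 := by
  have hc := h.locallyLipschitz.continuous
  apply le_antisymm
  · refine le_of_tendsto (hc.continuousWithinAt (s := Iio 0) (x := 0)) ?_
    filter_upwards [self_mem_nhdsWithin] with x hx
    have := h.mul_nonneg x
    exact nonpos_of_mul_nonneg_right this hx
  · refine ge_of_tendsto (hc.continuousWithinAt (s := Ioi 0) (x := 0)) ?_
    filter_upwards [self_mem_nhdsWithin] with x hx
    have := h.mul_nonneg x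
    exact nonneg_of_mul_nonneg_right this hx

theorem IsSaturation.a₂_pos (h : IsSaturation σ a₁ a₂ b₁ b₂ σinf) : 0 < a₂ :=
  h.a₁_pos.trans_le h.a_le

theorem IsSaturation.abs_apply_le (h : IsSaturation σ a₁ a₂ b₁ b₂ σinf) (x : ℝ) : |σ x| ≤ a₂ := by
  rcases eq_or_ne x 0 with rfl | hx
  · simpa [h.map_zero] using h.a₂_pos.le
  · have h1 := h.sector_upper x
    have h2 : |x| * |σ x| ≤ |x| * a₂ := by
      rw [← abs_mul, abs_of_nonneg (h.mul_nonneg x)]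
      refine h1.trans ((le_abs_self _).trans ?_)
      rw [abs_mul, abs_mul, abs_of_pos h.a₂_pos]
      have := abs_stdSat_le_one (x / b₂)
      have := mul_le_mul_of_nonneg_left this (by positivity [h.a₂_pos] : 0 ≤ a₂ * |x|)
      linarith
    exact le_of_mul_le_mul_left h2 (abs_pos.2 hx)

theorem IsSaturation.exists_slope (h : IsSaturation σ a₁ a₂ b₁ b₂ σinf) {y : ℝ}
    (hy : |y| ≤ min b₁ b₂) : ∃ ρ ∈ Icc (a₁ / b₁) (a₂ / b₂), σ y = ρ * y := by
  rcases eq_or_ne y 0 with rfl | hy0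
  · exact ⟨a₁ / b₁, left_mem_Icc.2 h.ratio_le, by simp [h.map_zero]⟩
  · have hsq : 0 < y ^ 2 := by positivity
    have hs : ∀ b, 0 < b → |y| ≤ b → stdSat (y / b) = y / b := fun b hb hyb =>
      stdSat_of_abs_le (by rw [abs_div, abs_of_pos hb, div_le_one hb]; exact hyb)
    have h1 := h.sector_lower y
    have h2 := h.sector_upper y
    rw [hs _ h.b₁_pos (hy.trans (min_le_left _ _))] at h1
    rw [hs _ h.b₂_pos (hy.trans (min_le_right _ _))] at h2
    have e : σ y / y = y * σ y / y ^ 2 := by field_simp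
    refine ⟨σ y / y, ⟨?_, ?_⟩, by field_simp⟩
    · rw [e, le_div_iff₀ hsq]
      calc a₁ / b₁ * y ^ 2 = a₁ * y * (y / b₁) := by ring
        _ ≤ _ := h1
    · rw [e, div_le_iff₀ hsq]
      calc _ ≤ a₂ * y * (y / b₂) := h2
        _ = _ := by ring

theorem IsSaturation.exists_abs_sub_le (h : IsSaturation σ a₁ a₂ b₁ b₂ σinf) :
    ∃ L > 0, ∀ y d : ℝ, |y| ≤ 1 → |σ (y + d) - σ y| ≤ L * |d| := by
  obtain ⟨K, hK⟩ := LocallyLipschitzOn.exists_lipschitzOnWith_of_compact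
    (isCompact_Icc (a := (-2 : ℝ)) (b := 2)) h.locallyLipschitz.locallyLipschitzOn
  have ha := h.a₂_pos
  refine ⟨K + 2 * a₂, by positivity, fun y d hy => ?_⟩
  rw [abs_le] at hy
  rcases le_total |d| 1 with hd | hd
  · have hd' := abs_le.1 hd
    have h1 := hK.dist_le_mul (y + d) ⟨by linarith, by linarith⟩ y ⟨by linarith, by linarith⟩
    rw [Real.dist_eq, Real.dist_eq, add_sub_cancel_left] at h1
    have := abs_nonneg d
    nlinarith
  · have h1 := abs_sub (σ (y + d)) (σ y)
    have h2 := h.abs_apply_le (y + d)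
    have h3 := h.abs_apply_le y
    have : (0 : ℝ) ≤ K := K.coe_nonneg
    nlinarith

/-- The defect `|w| - w σ(w + d) / σ_{+∞}` is at most a small multiple of `|w|` up to a constant
and a multiple of `|d|`. -/
theorem IsSaturation.exists_defect_le (h : IsSaturation σ a₁ a₂ b₁ b₂ σinf) {η : ℝ} (hη : 0 < η) :
    ∃ M > 0, ∀ w d : ℝ, |w| - w * σ (w + d) / σinf ≤ η * |w| + M * (1 + |d|) := by
  have hs := h.limit_pos
  have ha := h.a₂_pos
  have hlo : ∀ᶠ y in atTop, (1 - η) * σinf ≤ σ y :=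
    h.tendsto_atTop.eventually_const_le (by nlinarith)
  have hhi : ∀ᶠ y in atBot, σ y ≤ -((1 - η) * σinf) :=
    h.tendsto_atBot.eventually_le_const (by nlinarith)
  obtain ⟨R₁, hR₁⟩ := eventually_atTop.1 hlo
  obtain ⟨R₂, hR₂⟩ := eventually_atBot.1 hhi
  set R := |R₁| + |R₂| with hR
  have hR0 : 0 ≤ R := by positivity
  set B := 1 + a₂ / σinf with hB
  have hB0 : 0 < B := by positivity
  have hgen : ∀ w d : ℝ, |w| - w * σ (w + d) / σinf ≤ B * |w| := by
    intro w d
    have h1 : -(w * σ (w + d) / σinf) ≤ |w| * a₂ / σinf := by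
      rw [← neg_div]
      gcongr
      refine (neg_le_abs _).trans ?_
      rw [abs_mul]
      exact mul_le_mul_of_nonneg_left (h.abs_apply_le _) (abs_nonneg _)
    have : B * |w| = |w| + |w| * a₂ / σinf := by rw [hB]; ring
    linarith
  refine ⟨2 * (R + 1) * B, by positivity, fun w d => ?_⟩
  have hd0 := abs_nonneg d
  have hw0 := abs_nonneg w
  rcases le_total |w| (2 * |d|) with hwd | hwd
  · refine (hgen w d).trans ?_
    have h1 := mul_le_mul_of_nonneg_left hwd hB0.le
    have h2 : 0 ≤ R * B * |d| := by positivity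
    have h3 : 0 ≤ R * B := by positivity
    nlinarith
  · rcases le_total |w| (2 * R) with hwR | hwR
    · refine (hgen w d).trans ?_
      have h1 := mul_le_mul_of_nonneg_left hwR hB0.le
      have h2 : 0 ≤ R * B * |d| := by positivity
      have h3 : 0 ≤ R * B := by positivity
      have h4 : 0 ≤ B * |d| := by positivity
      nlinarith
    · have hmain : |w| - w * σ (w + d) / σinf ≤ η * |w| := by
        have hd1 := abs_le.1 (show |d| ≤ |w| / 2 by linarith)
        have hkey : (1 - η) * |w| * σinf ≤ w * σ (w + d) := by
          rcases le_total 0 w with hw | hw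
          · rw [abs_of_nonneg hw] at *
            have h1 := hR₁ (w + d) (by linarith [le_abs_self R₁, abs_nonneg R₂])
            nlinarith
          · rw [abs_of_nonpos hw] at *
            have h1 := hR₂ (w + d) (by linarith [neg_abs_le R₂, abs_nonneg R₁])
            nlinarith
        have h2 : (1 - η) * |w| ≤ w * σ (w + d) / σinf := by
          rwa [le_div_iff₀ hs]
        linarith
      refine hmain.trans ?_
      have : 0 ≤ 2 * (R + 1) * B * (1 + |d|) := by positivity
      linarith

end Saturation

/-! ### The quadratic norm -/

section Quadratic

variable {n : ℕ} {P : Matrix (Fin n) (Fin n) ℝ}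

theorem abs_dotProduct_le (x y : Fin n → ℝ) : |x ⬝ᵥ y| ≤ n * (‖x‖ * ‖y‖) := by
  have h : ∀ i ∈ Finset.univ, |x i * y i| ≤ ‖x‖ * ‖y‖ := fun i _ => by
    rw [abs_mul]
    exact mul_le_mul (norm_le_pi_norm x i) (norm_le_pi_norm y i) (abs_nonneg _) (norm_nonneg _)
  refine (Finset.abs_sum_le_sum_abs _ _).trans ?_
  simpa using Finset.sum_le_card_nsmul _ _ _ h

theorem sq_norm_le_dotProduct_self (x : Fin n → ℝ) : ‖x‖ ^ 2 ≤ x ⬝ᵥ x := by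
  have h0 : 0 ≤ x ⬝ᵥ x := Finset.sum_nonneg fun i _ => mul_self_nonneg _
  rw [← Real.le_sqrt (norm_nonneg _) h0, pi_norm_le_iff_of_nonneg (Real.sqrt_nonneg _)]
  intro i
  rw [Real.norm_eq_abs, Real.le_sqrt (abs_nonneg _) h0, sq_abs, sq]
  exact Finset.single_le_sum (f := fun i => x i * x i) (fun i _ => mul_self_nonneg _)
    (Finset.mem_univ i)

theorem dotProduct_mulVec_comm (hP : P.PosDef) (x y : Fin n → ℝ) :
    x ⬝ᵥ P.mulVec y = y ⬝ᵥ P.mulVec x := by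
  have hPt : P.transpose = P := hP.isHermitian
  rw [Matrix.dotProduct_mulVec, ← Matrix.mulVec_transpose, hPt, dotProduct_comm]

theorem dotProduct_mulVec_self_nonneg (hP : P.PosDef) (x : Fin n → ℝ) :
    0 ≤ x ⬝ᵥ P.mulVec x := by
  simpa using hP.posSemidef.dotProduct_mulVec_nonneg x

theorem sq_quadNorm (hP : P.PosDef) (x : Fin n → ℝ) : quadNorm P x ^ 2 = x ⬝ᵥ P.mulVec x :=
  Real.sq_sqrt (dotProduct_mulVec_self_nonneg hP x)

theorem quadNorm_nonneg (x : Fin n → ℝ) : 0 ≤ quadNorm P x := Real.sqrt_nonneg _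

theorem dotProduct_mulVec_le (hP : P.PosDef) (x y : Fin n → ℝ) :
    x ⬝ᵥ P.mulVec y ≤ quadNorm P x * quadNorm P y := by
  refine abs_le_of_sq_le_sq' ?_ (mul_nonneg (quadNorm_nonneg x) (quadNorm_nonneg y)) |>.2
  rw [mul_pow, sq_quadNorm hP, sq_quadNorm hP]
  have h := discrim_le_zero (a := y ⬝ᵥ P.mulVec y) (b := 2 * (x ⬝ᵥ P.mulVec y))
    (c := x ⬝ᵥ P.mulVec x) fun t => by
      have h1 := dotProduct_mulVec_self_nonneg hP (x + t • y)
      simp only [Matrix.mulVec_add, Matrix.mulVec_smul, dotProduct_add, add_dotProduct,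
        dotProduct_smul, smul_dotProduct, smul_eq_mul, dotProduct_mulVec_comm hP y x] at h1
      linarith
  rw [discrim] at h
  linarith

theorem quadNorm_add_le (hP : P.PosDef) (x y : Fin n → ℝ) :
    quadNorm P (x + y) ≤ quadNorm P x + quadNorm P y := by
  refine le_of_sq_le_sq ?_ (add_nonneg (quadNorm_nonneg x) (quadNorm_nonneg y))
  rw [sq_quadNorm hP, add_sq, sq_quadNorm hP, sq_quadNorm hP]
  simp only [Matrix.mulVec_add, dotProduct_add, add_dotProduct, dotProduct_mulVec_comm hP y x]
  linarith [dotProduct_mulVec_le hP x y]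

theorem exists_quadNorm_bounds (hP : P.PosDef) : ∃ c > 0, ∃ C > 0, ∀ x : Fin n → ℝ,
    c * ‖x‖ ≤ quadNorm P x ∧ quadNorm P x ≤ C * ‖x‖ := by
  obtain ⟨c, hc, hle⟩ := exists_le_dotProduct_mulVec hP
  set L := ‖LinearMap.toContinuousLinearMap P.mulVecLin‖ with hL
  have hLle : ∀ x : Fin n → ℝ, ‖P.mulVec x‖ ≤ L * ‖x‖ := fun x =>
    (LinearMap.toContinuousLinearMap P.mulVecLin).le_opNorm x
  have hL0 : 0 ≤ L := norm_nonneg _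
  refine ⟨√c, Real.sqrt_pos.2 hc, √(n * L + 1), Real.sqrt_pos.2 (by positivity), fun x => ⟨?_, ?_⟩⟩
  · refine le_of_sq_le_sq ?_ (quadNorm_nonneg x)
    rw [sq_quadNorm hP, mul_pow, Real.sq_sqrt hc.le]
    exact hle x
  · refine le_of_sq_le_sq ?_ (by positivity)
    rw [sq_quadNorm hP, mul_pow, Real.sq_sqrt (by positivity)]
    refine (le_abs_self _).trans ((abs_dotProduct_le _ _).trans ?_)
    have h1 := mul_le_mul_of_nonneg_left (hLle x) (norm_nonneg x)
    have h2 := mul_le_mul_of_nonneg_left h1 n.cast_nonneg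
    nlinarith [sq_nonneg ‖x‖]

theorem locallyLipschitz_quadNorm (hP : P.PosDef) : LocallyLipschitz (quadNorm P) := by
  obtain ⟨c, -, C, hC, hle⟩ := exists_quadNorm_bounds hP
  have : LipschitzWith ⟨C, hC.le⟩ (quadNorm P) := LipschitzWith.of_le_add_mul _ fun x y => by
    rw [dist_eq_norm]
    have h1 := quadNorm_add_le hP y (x - y)
    rw [add_sub_cancel] at h1
    exact h1.trans (by gcongr; exact (hle _).2)
  exact this.locallyLipschitz

theorem _root_.HasDerivAt.quadNorm (hP : P.PosDef) {x : ℝ → Fin n → ℝ} {v : Fin n → ℝ} {t : ℝ}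
    (hx : HasDerivAt x v t) (h0 : x t ≠ 0) :
    HasDerivAt (fun s => IntegratorChain.quadNorm P (x s))
      ((x t ⬝ᵥ P.mulVec v) / IntegratorChain.quadNorm P (x t)) t := by
  have hQ : HasDerivAt (fun s => x s ⬝ᵥ P.mulVec (x s))
      (v ⬝ᵥ P.mulVec (x t) + x t ⬝ᵥ P.mulVec v) t := by
    have hx' := hasDerivAt_pi.1 hx
    have hPx : ∀ i, HasDerivAt (fun s => P.mulVec (x s) i) (P.mulVec v i) t := fun i =>
      HasDerivAt.fun_sum (u := Finset.univ) fun j _ => (hx' j).const_mul (P i j)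
    have := HasDerivAt.fun_sum (u := Finset.univ) fun i _ => (hx' i).mul (hPx i)
    refine this.congr_deriv ?_
    rw [Finset.sum_add_distrib]
    rfl
  have hpos : 0 < x t ⬝ᵥ P.mulVec (x t) := by simpa using hP.dotProduct_mulVec_pos h0
  refine (hQ.sqrt hpos.ne').congr_deriv ?_
  rw [dotProduct_mulVec_comm hP v, IntegratorChain.quadNorm]
  have : √(x t ⬝ᵥ P.mulVec (x t)) ≠ 0 := (Real.sqrt_pos.2 hpos).ne'
  field_simp
  ring

end Quadratic

/-! ### The composite Lyapunov function -/

section Composite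

variable {n : ℕ}

theorem exists_abs_omegaFun_le (hn : 2 ≤ n) (l : ℕ → ℝ) : ∃ C > 0, ∀ x : Fin n → ℝ,
    |omegaFun l x n| ≤ C * lyap l x ^ (2 * ((n : ℝ) - 1) / (2 * n - 1)) := by
  obtain ⟨C, hC, hle⟩ := (isHomogeneous_omegaFun_last hn l).abs.exists_le_mul hn
    (isHomogeneous_lyap_rpow hn l) (contDiff_omegaFun_last hn l).continuous.abs
    (continuous_lyap_rpow hn l) fun x hx => Real.rpow_pos_of_pos (lyap_pos hn l hx) _
  refine ⟨C, hC, fun x => ?_⟩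
  rcases eq_or_ne x 0 with rfl | hx
  · rw [omegaFun_zero_left, abs_zero]
    have := lyap_nonneg hn l (0 : Fin n → ℝ)
    positivity
  · exact hle x hx

theorem exists_norm_le_lyap (hn : 2 ≤ n) (l : ℕ → ℝ) {r : ℝ} (hr : 0 < r) :
    ∃ m > 0, ∀ x : Fin n → ℝ, r ≤ ‖x‖ →
      ‖x‖ ≤ m * lyap l x ^ (2 * ((n : ℝ) - 1) / (2 * n - 1)) := by
  have : Nonempty (Fin n) := ⟨⟨0, by omega⟩⟩
  have hn' : (2 : ℝ) ≤ n := by exact_mod_cast hn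
  have hcoord : ∀ i : Fin n, ∃ m > 0, ∀ x : Fin n → ℝ, r ≤ |x i| →
      |x i| ≤ m * lyap l x ^ (2 * ((n : ℝ) - 1) / (2 * n - 1)) := by
    intro i
    have hw := wt_succ_pos hn i.isLt
    set e := 2 * ((n : ℝ) - 1) / n / wt n (i + 1) with he
    have he1 : 1 ≤ e := by
      rw [he, one_le_div hw]
      refine (wt_succ_le_one hn).trans ?_
      rw [one_le_div (by linarith)]
      linarith
    have hh : IsHomogeneous (fun x : Fin n → ℝ => |coord x (i + 1)| ^ e)
        (2 * ((n : ℝ) - 1) / n) := by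
      have := (isHomogeneous_coord (n := n) (i + 1)).abs.rpow (fun _ => abs_nonneg _) e
      rwa [he, mul_div_cancel₀ _ hw.ne'] at this
    obtain ⟨C, hC, hle⟩ := hh.exists_le_mul hn (isHomogeneous_lyap_rpow hn l)
      ((contDiff_coord _).continuous.abs.rpow_const fun _ => Or.inr (by linarith))
      (continuous_lyap_rpow hn l) fun x hx => Real.rpow_pos_of_pos (lyap_pos hn l hx) _
    refine ⟨r / r ^ e * C, by positivity, fun x hx => ?_⟩
    have hx0 : x ≠ 0 := by
      rintro rfl
      simp at hx
      linarith
    have h1 := hle x hx0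
    simp only [coord_succ] at h1
    have h2 : |x i| / r ≤ |x i| ^ e / r ^ e := by
      rw [← Real.div_rpow (abs_nonneg _) hr.le]
      exact Real.self_le_rpow_of_one_le ((one_le_div hr).2 hx) he1
    calc |x i| = r * (|x i| / r) := by field_simp
      _ ≤ r * (|x i| ^ e / r ^ e) := by gcongr
      _ = r / r ^ e * |x i| ^ e := by ring
      _ ≤ r / r ^ e * (C * _) := by gcongr
      _ = _ := by ring
  choose m hm hle using hcoord
  refine ⟨∑ i, m i, Finset.sum_pos (fun i _ => hm i) Finset.univ_nonempty, fun x hx => ?_⟩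
  obtain ⟨i, hi⟩ := Finite.exists_max fun j => |x j|
  have hxi : ‖x‖ = |x i| := le_antisymm
    ((pi_norm_le_iff_of_nonneg (abs_nonneg _)).2 hi) (norm_le_pi_norm x i)
  rw [hxi] at hx ⊢
  refine (hle i x hx).trans (mul_le_mul_of_nonneg_right ?_
    (Real.rpow_nonneg (lyap_nonneg hn l x) _))
  exact Finset.single_le_sum (fun j _ => (hm j).le) (Finset.mem_univ i)

/-- A `C¹` function vanishing at `0` is bounded by a multiple of the norm on every ball. -/
theorem exists_abs_le_mul_norm {f : (Fin n → ℝ) → ℝ} (hf : ContDiff ℝ 1 f) (h0 : f 0 = 0)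
    (R : ℝ) : ∃ K > 0, ∀ x, ‖x‖ ≤ R → |f x| ≤ K * ‖x‖ := by
  obtain ⟨K, hK⟩ := LocallyLipschitzOn.exists_lipschitzOnWith_of_compact
    (isCompact_closedBall (0 : Fin n → ℝ) R) hf.locallyLipschitz.locallyLipschitzOn
  refine ⟨K + 1, by positivity, fun x hx => ?_⟩
  have h1 := hK.dist_le_mul x (by simpa using hx) 0
    (by simpa using (norm_nonneg x).trans hx)
  rw [h0, Real.dist_eq, sub_zero, dist_zero_right] at h1
  linarith [norm_nonneg x]

/-- The decay rate `min(r, r^α)` of the composite Lyapunov function. -/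
noncomputable def decayRate (α r : ℝ) : ℝ := min (max r 0) (max r 0 ^ α)

theorem continuous_decayRate {α : ℝ} (hα : 0 < α) : Continuous (decayRate α) := by
  have h : Continuous fun r : ℝ => max r 0 := continuous_id.max continuous_const
  exact h.min (h.rpow_const fun _ => Or.inr hα.le)

theorem monotone_decayRate {α : ℝ} (hα : 0 < α) : Monotone (decayRate α) := fun _ _ h =>
  min_le_min (max_le_max_right 0 h)
    (Real.rpow_le_rpow (le_max_right _ _) (max_le_max_right 0 h) hα.le)

theorem decayRate_zero (α : ℝ) : decayRate α 0 = 0 := by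
  rw [decayRate, max_self]
  exact min_eq_left (Real.rpow_nonneg le_rfl _)

theorem decayRate_nonneg (α r : ℝ) : 0 ≤ decayRate α r :=
  le_min (le_max_right _ _) (Real.rpow_nonneg (le_max_right _ _) _)

theorem decayRate_le_self (α : ℝ) {r : ℝ} (hr : 0 ≤ r) : decayRate α r ≤ r := by
  rw [decayRate, max_eq_left hr]
  exact min_le_left _ _

theorem decayRate_le_rpow (α : ℝ) {r : ℝ} (hr : 0 ≤ r) : decayRate α r ≤ r ^ α := by
  rw [decayRate, max_eq_left hr]
  exact min_le_right _ _

theorem le_decayRate_of_le {α r R : ℝ} (hα : 0 < α) (hα1 : α ≤ 1) (hr : 0 ≤ r) (hR : 1 ≤ R)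
    (hrR : r ≤ R) : r / R ≤ decayRate α r := by
  rw [decayRate, max_eq_left hr]
  refine le_min (div_le_self hr hR) ?_
  rcases le_total r 1 with h | h
  · refine (div_le_self hr hR).trans ?_
    rcases hr.eq_or_lt with rfl | hr
    · exact Real.rpow_nonneg le_rfl _
    · simpa using Real.rpow_le_rpow_of_exponent_ge hr h hα1
  · exact ((div_le_one (by linarith)).2 hrR).trans (Real.one_le_rpow h hα.le)

theorem mul_rpow_le_decayRate_add {α v b : ℝ} (hα : 0 < α) (hα1 : α ≤ 1) (hv : 0 ≤ v)
    (hb : 0 ≤ b) : min 1 b * v ^ α ≤ decayRate α (v + b) := by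
  have hm0 : 0 ≤ min 1 b := le_min zero_le_one hb
  have hv0 : 0 ≤ v ^ α := Real.rpow_nonneg hv _
  rw [decayRate, max_eq_left (by linarith)]
  refine le_min ?_ ?_
  · rcases le_total v 1 with h | h
    · have h1 : v ^ α ≤ 1 := Real.rpow_le_one hv h hα.le
      have h2 := mul_le_mul_of_nonneg_left h1 hm0
      linarith [min_le_right 1 b]
    · have h1 : v ^ α ≤ v := by simpa using Real.rpow_le_rpow_of_exponent_le h hα1
      have h2 := mul_le_mul_of_nonneg_right (min_le_left 1 b) hv0
      linarith
  · have h1 : v ^ α ≤ (v + b) ^ α := Real.rpow_le_rpow hv (by linarith) hα.le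
    have h2 := mul_le_mul_of_nonneg_right (min_le_left 1 b) hv0
    linarith

/-- The composite Lyapunov function `V_n + B min(V_0, A)`. -/
noncomputable def compositeLyap (l : ℕ → ℝ) (P : Matrix (Fin n) (Fin n) ℝ) (A B : ℝ)
    (x : Fin n → ℝ) : ℝ := lyap l x + B * min (quadNorm P x) A

variable {l : ℕ → ℝ} {σ : ℝ → ℝ} {a₁ a₂ b₁ b₂ σinf A : ℝ} {K : Fin n → ℝ}
  {P : Matrix (Fin n) (Fin n) ℝ}

/-- Outside `{V_0 ≤ A}` the homogeneous feedback makes `V_n` decrease, if the gain is large. -/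
theorem exists_fderiv_lyap_le_outside (hn : 2 ≤ n) (hl : AdmissibleGains n l)
    (hσ : IsSaturation σ a₁ a₂ b₁ b₂ σinf) {v : ℝ} (hv : 0 < v) :
    ∃ k₀ > 0, ∃ c > 0, ∃ E > 0, ∀ k ≥ k₀, ∀ (x : Fin n → ℝ) (d : ℝ),
      v ≤ lyap l x ^ (2 * ((n : ℝ) - 1) / (2 * n - 1)) →
      fderiv ℝ (lyap l) x ((jordanBlock n).mulVec x +
        (-(l n / σinf) * σ (k * omegaFun l x n + d)) • lastVec n) ≤
      -c * lyap l x ^ (2 * ((n : ℝ) - 1) / (2 * n - 1)) + E * |d| := by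
  obtain ⟨hlpos, c, hc, hle⟩ := hl
  have hln : 0 < l n := hlpos n (by omega) le_rfl
  obtain ⟨Cω, hCω, hω⟩ := exists_abs_omegaFun_le hn l
  obtain ⟨M, hM, hdef⟩ := hσ.exists_defect_le (η := c / (4 * l n * Cω)) (by positivity)
  have hs := hσ.limit_pos
  refine ⟨4 * l n * M / (c * v), by positivity, c / 2, by positivity, c * v / 4, by positivity,
    fun k hk x d hx => (hle x _).trans ?_⟩
  set V := lyap l x ^ (2 * ((n : ℝ) - 1) / (2 * n - 1)) with hV
  have hk0 : 0 < k := lt_of_lt_of_le (by positivity) hk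
  set w := omegaFun l x n with hw
  have h1 : w * (-(l n / σinf) * σ (k * w + d) + l n * Real.sign w) =
      l n / k * (|k * w| - k * w * σ (k * w + d) / σinf) := by
    rw [abs_mul, abs_of_pos hk0, ← mul_sign_eq_abs w]
    field_simp
    ring
  have h2 := mul_le_mul_of_nonneg_left (hdef (k * w) d) (by positivity : 0 ≤ l n / k)
  rw [h1]
  have h3 : l n / k * (c / (4 * l n * Cω) * |k * w| + M * (1 + |d|)) =
      c / (4 * Cω) * |w| + l n * M / k * (1 + |d|) := by
    rw [abs_mul, abs_of_pos hk0]
    field_simp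
  rw [h3] at h2
  have h4 : c / (4 * Cω) * |w| ≤ c / 4 * V := by
    calc c / (4 * Cω) * |w| ≤ c / (4 * Cω) * (Cω * V) := by gcongr; exact hω x
      _ = c / 4 * V := by field_simp
  have h5 : l n * M / k ≤ c * v / 4 := by
    rw [div_le_iff₀ hk0]
    rw [ge_iff_le, div_le_iff₀ (by positivity)] at hk
    linarith
  have h6 := mul_le_mul_of_nonneg_right h5 (by positivity : 0 ≤ 1 + |d|)
  have h7 := mul_le_mul_of_nonneg_left hx hc.le
  linarith

/-- Inside `{V_0 ≤ A}` the linear feedback makes `V_0` decrease. -/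
theorem exists_quadratic_le_inside (hσ : IsSaturation σ a₁ a₂ b₁ b₂ σinf) {g : ℝ} (hg : 0 < g)
    (hKP : RobustLyapunovPair n g (a₁ / b₁) (a₂ / b₂) K P) :
    ∃ c > 0, ∃ C > 0, ∀ (x : Fin n → ℝ) (d : ℝ), x ≠ 0 → |K ⬝ᵥ x| ≤ min 1 (min b₁ b₂) →
      (x ⬝ᵥ P.mulVec ((jordanBlock n).mulVec x + (-g * σ (K ⬝ᵥ x + d)) • lastVec n)) /
        quadNorm P x ≤ -c * ‖x‖ + C * |d| := by
  obtain ⟨hP, hLy⟩ := hKP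
  obtain ⟨c₀, hc₀, C₀, hC₀, hq⟩ := exists_quadNorm_bounds hP
  obtain ⟨L, hL, hLip⟩ := hσ.exists_abs_sub_le
  set β := (n : ℝ) * ‖P.mulVec (lastVec n)‖ * (g * L) + 1 with hβ
  have hβ0 : 0 < β := by positivity
  refine ⟨1 / (2 * C₀), by positivity, β / c₀, by positivity, fun x d hx hKx => ?_⟩
  have hxn : 0 < ‖x‖ := norm_pos_iff.2 hx
  obtain ⟨ρ, hρ, hσρ⟩ := hσ.exists_slope (hKx.trans (min_le_right _ _))
  set y := K ⬝ᵥ x with hy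
  set Mρ := jordanBlock n - (ρ * g) • Matrix.vecMulVec (lastVec n) K with hMρ
  have hvec : (jordanBlock n).mulVec x + (-g * σ (y + d)) • lastVec n =
      Mρ.mulVec x + (-g * (σ (y + d) - σ y)) • lastVec n := by
    have : (Matrix.vecMulVec (lastVec n) K).mulVec x = y • lastVec n := by
      rw [Matrix.vecMulVec_mulVec, hy]
      ext i
      simp [mul_comm]
    rw [hMρ, Matrix.sub_mulVec, Matrix.smul_mulVec, this, hσρ, smul_smul]
    ext i
    simp only [Pi.add_apply, Pi.sub_apply, Pi.smul_apply, smul_eq_mul]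
    ring
  have hM : x ⬝ᵥ P.mulVec (Mρ.mulVec x) ≤ -(1 / 2) * ‖x‖ ^ 2 := by
    have h1 := (hLy ρ hρ).dotProduct_mulVec_nonneg x
    rw [star_trivial, Matrix.sub_mulVec, Matrix.neg_mulVec, Matrix.one_mulVec, Matrix.add_mulVec,
      dotProduct_sub, dotProduct_neg, dotProduct_add, ← Matrix.mulVec_mulVec,
      ← Matrix.mulVec_mulVec, Matrix.dotProduct_mulVec _ (Matrix.transpose _),
      Matrix.vecMul_transpose, dotProduct_mulVec_comm hP (Matrix.mulVec _ _) x] at h1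
    have h2 := sq_norm_le_dotProduct_self x
    linarith
  have hE : (-g * (σ (y + d) - σ y)) * (x ⬝ᵥ P.mulVec (lastVec n)) ≤ β * (‖x‖ * |d|) := by
    refine (le_abs_self _).trans ?_
    rw [abs_mul, abs_mul, abs_neg, abs_of_pos hg]
    have h1 := hLip y d (hKx.trans (min_le_left _ _))
    have h2 := abs_dotProduct_le x (P.mulVec (lastVec n))
    calc g * |σ (y + d) - σ y| * |x ⬝ᵥ P.mulVec (lastVec n)|
        ≤ g * (L * |d|) * (n * (‖x‖ * ‖P.mulVec (lastVec n)‖)) := by gcongr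
      _ = (β - 1) * (‖x‖ * |d|) := by rw [hβ]; ring
      _ ≤ β * (‖x‖ * |d|) := by gcongr; linarith
  have hqpos : 0 < quadNorm P x := lt_of_lt_of_le (by positivity) (hq x).1
  rw [hvec, Matrix.mulVec_add, Matrix.mulVec_smul, dotProduct_add, dotProduct_smul, smul_eq_mul,
    div_le_iff₀ hqpos]
  have h1 : 1 / (2 * C₀) * ‖x‖ * quadNorm P x ≤ 1 / 2 * ‖x‖ ^ 2 := by
    calc 1 / (2 * C₀) * ‖x‖ * quadNorm P x ≤ 1 / (2 * C₀) * ‖x‖ * (C₀ * ‖x‖) := by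
          gcongr; exact (hq x).2
      _ = 1 / 2 * ‖x‖ ^ 2 := by field_simp
  have h2 : β * (‖x‖ * |d|) ≤ β / c₀ * |d| * quadNorm P x := by
    calc β * (‖x‖ * |d|) = β / c₀ * |d| * (c₀ * ‖x‖) := by field_simp
      _ ≤ _ := by gcongr; exact (hq x).1
  linarith

/-- Inside `{V_0 ≤ A}` the derivative of `V_n` is at most a multiple of the norm. -/
theorem exists_fderiv_lyap_le_inside (hn : 2 ≤ n) (hl : AdmissibleGains n l) (R a : ℝ)
    (ha : 0 ≤ a) : ∃ C > 0, ∀ (x : Fin n → ℝ) (u : ℝ), ‖x‖ ≤ R → |u| ≤ a →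
      fderiv ℝ (lyap l) x ((jordanBlock n).mulVec x + u • lastVec n) ≤ C * ‖x‖ := by
  obtain ⟨hlpos, c, hc, hle⟩ := hl
  have hln : 0 < l n := hlpos n (by omega) le_rfl
  obtain ⟨M, hM, hω⟩ := exists_abs_le_mul_norm (contDiff_omegaFun_last hn l)
    (omegaFun_zero_left l n) R
  refine ⟨(a + l n) * M, by positivity, fun x u hx hu => (hle x u).trans ?_⟩
  have h1 := Real.rpow_nonneg (lyap_nonneg hn l x) (2 * ((n : ℝ) - 1) / (2 * n - 1))
  have h2 : omegaFun l x n * (u + l n * Real.sign (omegaFun l x n)) ≤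
      |omegaFun l x n| * (a + l n) := by
    rw [mul_add, mul_left_comm, mul_sign_eq_abs]
    have : omegaFun l x n * u ≤ |omegaFun l x n| * a := by
      refine (le_abs_self _).trans ?_
      rw [abs_mul]
      gcongr
    linarith
  have h3 := mul_le_mul_of_nonneg_right (hω x hx) (by positivity : 0 ≤ a + l n)
  nlinarith

theorem ae_differentiableAt_timeInterval {T : ℝ≥0∞} {f : ℝ → ℝ}
    (hf : ∀ t ∈ timeInterval T, AbsolutelyContinuousOnInterval f 0 t) :
    ∀ᵐ t ∂(volume.restrict (timeInterval T)), DifferentiableAt ℝ f t := by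
  rw [ae_restrict_iff' (measurableSet_timeInterval T)]
  have h : ∀ᵐ t, ∀ q : {q : ℚ // (q : ℝ) ∈ timeInterval T},
      t ∈ uIcc 0 ((q : ℚ) : ℝ) → DifferentiableAt ℝ f t :=
    ae_all_iff.2 fun q => (hf _ q.2).ae_differentiableAt
  filter_upwards [h] with t ht hmem
  rw [timeInterval_eq_iUnion] at hmem
  obtain ⟨q, hq⟩ := mem_iUnion.1 hmem
  exact ht q (Icc_subset_uIcc hq)

theorem exists_hasDerivAt_compositeLyap (hn : 2 ≤ n) (hP : P.PosDef) (hA : 0 < A) (B : ℝ)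
    {x : ℝ → Fin n → ℝ} {v : Fin n → ℝ} {t : ℝ} (hx : HasDerivAt x v t)
    (hd : DifferentiableAt ℝ (fun s => min (quadNorm P (x s)) A) t) :
    ∃ q : ℝ, HasDerivAt (fun s => compositeLyap l P A B (x s))
        (fderiv ℝ (lyap l) (x t) v + B * q) t ∧
      (A < quadNorm P (x t) → q = 0) ∧ (x t = 0 → q = 0) ∧
      (quadNorm P (x t) ≤ A → x t ≠ 0 → q = (x t ⬝ᵥ P.mulVec v) / quadNorm P (x t)) := by
  have hm := hd.hasDerivAt
  refine ⟨deriv (fun s => min (quadNorm P (x s)) A) t, ?_, fun h => ?_, fun h => ?_,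
    fun h h0 => ?_⟩
  · have h1 := ((contDiff_lyap hn l).differentiable one_ne_zero (x t)).hasFDerivAt.comp_hasDerivAt
      t hx
    exact h1.add (hm.const_mul B)
  · refine IsLocalMax.hasDerivAt_eq_zero (Eventually.of_forall fun s => ?_) hm
    simp only [min_eq_right h.le]
    exact min_le_right _ _
  · refine IsLocalMin.hasDerivAt_eq_zero (Eventually.of_forall fun s => ?_) hm
    have : quadNorm P (x t) = 0 := by simp [h, quadNorm]
    simp only [this, min_eq_left hA.le]
    exact le_min (quadNorm_nonneg _) hA.le
  · have h1 := (hx.quadNorm hP h0).sub hm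
    have h2 := IsLocalMin.hasDerivAt_eq_zero (Eventually.of_forall fun s => ?_) h1
    · linarith
    · simp only [Pi.sub_apply, min_eq_left h, sub_self, sub_nonneg]
      exact min_le_left _ _

/-- The switched feedback gives finite gain in every `L_p` if its gain `k` is large. -/
theorem exists_isFiniteGainLpStabilizing_switchedFeedback (hn : 2 ≤ n) (hl : AdmissibleGains n l)
    (hσ : IsSaturation σ a₁ a₂ b₁ b₂ σinf)
    (hKP : RobustLyapunovPair n (l n / σinf) (a₁ / b₁) (a₂ / b₂) K P) (hA : 0 < A)
    (hKA : ∀ x : Fin n → ℝ, quadNorm P x ≤ A → |K ⬝ᵥ x| ≤ min 1 (min b₁ b₂)) :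
    ∃ k₀ > 0, ∀ k ≥ k₀, ∀ p : ℝ≥0∞, 1 ≤ p →
      IsFiniteGainLpStabilizing n (fun s => -(l n / σinf) * σ s)
        (fun x => k * switchedFeedback l K P A k x) p := by
  have hP := hKP.1
  have hln : 0 < l n := hl.1 n (by omega) le_rfl
  have hs := hσ.limit_pos
  set g := l n / σinf with hg
  have hg0 : 0 < g := by positivity
  set α := 2 * ((n : ℝ) - 1) / (2 * n - 1) with hα
  have hα0 : 0 < α := lyap_exponent_pos hn
  have hα1 : α ≤ 1 := lyap_exponent_le_one hn
  obtain ⟨c₀, hc₀, C₀, hC₀, hq⟩ := exists_quadNorm_bounds hP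
  obtain ⟨m, hm, hmle⟩ := exists_norm_le_lyap hn l (r := A / C₀) (by positivity)
  have hout : ∀ x : Fin n → ℝ, A < quadNorm P x → A / C₀ ≤ ‖x‖ := fun x hx => by
    rw [div_le_iff₀ hC₀, mul_comm]
    exact hx.le.trans (hq x).2
  set v := A / C₀ / m with hv
  have hv0 : 0 < v := by positivity
  have hvle : ∀ x : Fin n → ℝ, A < quadNorm P x → v ≤ lyap l x ^ α := fun x hx => by
    rw [hv, div_le_iff₀ hm, mul_comm]
    exact (hout x hx).trans (hmle x (hout x hx))
  obtain ⟨k₀, hk₀, c₁, hc₁, E, hE, hdout⟩ := exists_fderiv_lyap_le_outside hn hl hσ hv0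
  obtain ⟨c₂, hc₂, C₂, hC₂, hquad⟩ := exists_quadratic_le_inside hσ hg0 hKP
  have ha₂ := hσ.a₂_pos
  obtain ⟨C₁, hC₁, hdin⟩ := exists_fderiv_lyap_le_inside hn hl (A / c₀) (g * a₂) (by positivity)
  have hin : ∀ x : Fin n → ℝ, quadNorm P x ≤ A → ‖x‖ ≤ A / c₀ := fun x hx => by
    rw [le_div_iff₀ hc₀, mul_comm]
    exact (hq x).1.trans hx
  obtain ⟨C₃, hC₃, hVin⟩ := exists_abs_le_mul_norm (contDiff_lyap hn l) (lyap_zero hn l) (A / c₀)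
  set B := (C₁ + 1) / c₂ with hB
  have hB0 : 0 < B := by positivity
  set U : (Fin n → ℝ) → ℝ := compositeLyap l P A B with hU
  have hVnn := lyap_nonneg hn l
  have hUnn : ∀ x, 0 ≤ U x := fun x => by
    have h1 := hVnn x
    have h2 : 0 ≤ min (quadNorm P x) A := le_min (quadNorm_nonneg x) hA.le
    exact add_nonneg h1 (mul_nonneg hB0.le h2)
  have hUin : ∀ x, quadNorm P x ≤ A → U x = lyap l x + B * quadNorm P x := fun x hx => by
    rw [hU, compositeLyap, min_eq_left hx]
  have hUout : ∀ x, A < quadNorm P x → U x = lyap l x + B * A := fun x hx => by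
    rw [hU, compositeLyap, min_eq_right hx.le]
  have hU0 : U 0 = 0 := by
    rw [hUin 0 (by simpa [quadNorm] using hA.le), lyap_zero hn]
    simp [quadNorm]
  -- comparison of the rate of decay with the two regimes
  set C₄ := C₃ + B * C₀ with hC₄
  have hC₄0 : 0 < C₄ := by positivity
  have hUle : ∀ x, quadNorm P x ≤ A → U x ≤ C₄ * ‖x‖ := fun x hx => by
    rw [hUin x hx, hC₄, add_mul, mul_assoc]
    have h1 := (le_abs_self _).trans (hVin x (hin x hx))
    have h2 := mul_le_mul_of_nonneg_left (hq x).2 hB0.le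
    linarith
  have hψin : ∀ x, quadNorm P x ≤ A → decayRate α (U x) ≤ C₄ * ‖x‖ := fun x hx =>
    (decayRate_le_self α (hUnn x)).trans (hUle x hx)
  set C₅ := 1 + (B * A) ^ α / v with hC₅
  have hC₅0 : 0 < C₅ := by positivity
  have hψout : ∀ x, A < quadNorm P x → decayRate α (U x) ≤ C₅ * lyap l x ^ α := fun x hx => by
    refine (decayRate_le_rpow α (hUnn x)).trans ?_
    rw [hUout x hx]
    refine (Real.rpow_add_le_add_rpow (hVnn x) (by positivity) hα0.le hα1).trans ?_
    have h1 : (B * A) ^ α ≤ (B * A) ^ α / v * lyap l x ^ α := by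
      calc (B * A) ^ α = (B * A) ^ α / v * v := (div_mul_cancel₀ _ hv0.ne').symm
        _ ≤ _ := mul_le_mul_of_nonneg_left (hvle x hx) (by positivity)
    rw [hC₅, add_mul, one_mul]
    linarith
  have hnorm : ∃ M > 0, ∀ x, ‖x‖ ≤ M * decayRate α (U x) := by
    set R := max 1 (C₄ * (A / c₀)) with hR
    have hR1 : 1 ≤ R := le_max_left _ _
    have hR0 : 0 < R := by linarith
    have hb : 0 < min 1 (B * A) := lt_min one_pos (by positivity)
    refine ⟨R / (B * c₀) + m / min 1 (B * A), by positivity, fun x => ?_⟩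
    have hψ := decayRate_nonneg α (U x)
    rcases le_or_gt (quadNorm P x) A with hx | hx
    · have h1 : U x / R ≤ decayRate α (U x) := by
        refine le_decayRate_of_le hα0 hα1 (hUnn x) hR1 (((hUle x hx).trans ?_).trans
          (le_max_right _ _))
        exact mul_le_mul_of_nonneg_left (hin x hx) hC₄0.le
      have h2 : B * c₀ * ‖x‖ ≤ U x := by
        rw [hUin x hx]
        have := mul_le_mul_of_nonneg_left (hq x).1 hB0.le
        linarith [hVnn x]
      rw [div_le_iff₀ hR0] at h1
      have h3 : ‖x‖ ≤ R / (B * c₀) * decayRate α (U x) := by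
        rw [div_mul_eq_mul_div, le_div_iff₀ (by positivity)]
        linarith
      have h4 : 0 ≤ m / min 1 (B * A) * decayRate α (U x) := by positivity
      linarith
    · have h1 := mul_rpow_le_decayRate_add hα0 hα1 (hVnn x) (by positivity : 0 ≤ B * A)
      rw [← hUout x hx] at h1
      have h2 := hmle x (hout x hx)
      have h3 : ‖x‖ ≤ m / min 1 (B * A) * decayRate α (U x) := by
        rw [div_mul_eq_mul_div, le_div_iff₀ hb]
        calc ‖x‖ * min 1 (B * A) ≤ m * lyap l x ^ α * min 1 (B * A) := by gcongr
          _ = m * (min 1 (B * A) * lyap l x ^ α) := by ring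
          _ ≤ _ := by gcongr
      have h4 : 0 ≤ R / (B * c₀) * decayRate α (U x) := by positivity
      linarith
  obtain ⟨M, hM, hMle⟩ := hnorm
  obtain ⟨N, hN, hNle⟩ : ∃ N > 0, ∀ x : Fin n → ℝ, ‖WithLp.toLp 2 x‖ ≤ N * ‖x‖ := by
    refine ⟨‖((PiLp.continuousLinearEquiv 2 ℝ fun _ : Fin n => ℝ).symm :
      (Fin n → ℝ) →L[ℝ] PiLp 2 fun _ : Fin n => ℝ)‖ + 1, by positivity, fun x => ?_⟩
    refine (((PiLp.continuousLinearEquiv 2 ℝ fun _ : Fin n => ℝ).symm :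
      (Fin n → ℝ) →L[ℝ] PiLp 2 fun _ : Fin n => ℝ).le_opNorm x).trans ?_
    gcongr
    linarith
  refine ⟨k₀, hk₀, fun k hk p hp => ?_⟩
  have hk0 : 0 < k := lt_of_lt_of_le hk₀ hk
  have hlipmin : LocallyLipschitz fun x => min (quadNorm P x) A :=
    (LipschitzWith.id.min_const A).locallyLipschitz.comp (locallyLipschitz_quadNorm hP)
  have hUlip : LocallyLipschitz U := by
    have h1 : LocallyLipschitz fun x => B * min (quadNorm P x) A :=
      (lipschitzWith_smul B).locallyLipschitz.comp hlipmin
    exact (contDiff_lyap hn l).locallyLipschitz.add h1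
  refine isFiniteGainLpStabilizing_of_lyapunov (U := U) (ψ := decayRate α)
    (c := min (1 / C₄) (c₁ / C₅)) (C := B * C₂ + E) (M := N * M) hUlip hU0 hUnn
    (continuous_decayRate hα0) (monotone_decayRate hα0) (decayRate_zero α) (decayRate_nonneg α)
    (lt_min (by positivity) (by positivity)) (by positivity) (by positivity)
    (fun x => ?_) (fun d T x hT => ?_) p hp
  · rw [mul_assoc]
    exact (hNle x).trans (mul_le_mul_of_nonneg_left (hMle x) hN.le)
  · have hae := ae_differentiableAt_timeInterval (T := T)
      (f := fun t => min (quadNorm P (x t)) A)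
      fun t ht => hlipmin.comp_absolutelyContinuousOnInterval (hT.1 t ht)
    filter_upwards [hT.2, hae] with t hxt hdt
    obtain ⟨q, hder, hq1, hq2, hq3⟩ := exists_hasDerivAt_compositeLyap (l := l) hn hP hA B hxt hdt
    refine ⟨_, hder, ?_⟩
    have hd0 := abs_nonneg (d t)
    have hψ := decayRate_nonneg α (U (x t))
    rcases le_or_gt (quadNorm P (x t)) A with hx | hx
    · have hsw : k * switchedFeedback l K P A k (x t) = K ⬝ᵥ x t := by
        rw [switchedFeedback, if_neg (not_lt.2 hx), mul_div_cancel₀ _ hk0.ne']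
      simp only [hsw] at hq3 ⊢
      have h1 := hdin (x t) (-g * σ (K ⬝ᵥ x t + d t)) (hin _ hx) (by
        rw [abs_mul, abs_neg, abs_of_pos hg0]
        exact mul_le_mul_of_nonneg_left (hσ.abs_apply_le _) hg0.le)
      have h2 : q ≤ -c₂ * ‖x t‖ + C₂ * |d t| := by
        rcases eq_or_ne (x t) 0 with h0 | h0
        · rw [hq2 h0, h0, norm_zero]
          have := mul_nonneg hC₂.le hd0
          linarith
        · rw [hq3 hx h0]
          exact hquad (x t) (d t) h0 (hKA _ hx)
      have h3 := mul_le_mul_of_nonneg_left h2 hB0.le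
      have h4 : B * (-c₂ * ‖x t‖ + C₂ * |d t|) = -(C₁ + 1) * ‖x t‖ + B * C₂ * |d t| := by
        rw [hB]; field_simp
      have h5 : min (1 / C₄) (c₁ / C₅) * decayRate α (U (x t)) ≤ ‖x t‖ := by
        calc min (1 / C₄) (c₁ / C₅) * decayRate α (U (x t))
            ≤ 1 / C₄ * (C₄ * ‖x t‖) := by
              gcongr
              · exact min_le_left _ _
              · exact hψin _ hx
          _ = ‖x t‖ := by field_simp
      have h6 : 0 ≤ E * |d t| := by positivity
      linarith
    · have hsw : switchedFeedback l K P A k (x t) = omegaFun l (x t) n := by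
        rw [switchedFeedback, if_pos hx]
      rw [hq1 hx, mul_zero, add_zero]
      simp only [hsw]
      have h1 := hdout k hk (x t) (d t) (hvle _ hx)
      have h5 : min (1 / C₄) (c₁ / C₅) * decayRate α (U (x t)) ≤ c₁ * lyap l (x t) ^ α := by
        calc min (1 / C₄) (c₁ / C₅) * decayRate α (U (x t))
            ≤ c₁ / C₅ * (C₅ * lyap l (x t) ^ α) := by
              gcongr
              · exact min_le_right _ _
              · exact hψout _ hx
          _ = c₁ * lyap l (x t) ^ α := by field_simp
      have h6 : 0 ≤ B * C₂ * |d t| := by positivity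
      linarith

end Composite

/-! ### Rescaling the state -/

section Rescale

variable {n : ℕ}

/-- Finite gain is inherited by the system whose state is rescaled by `g` and whose input is
reflected. -/
theorem IsFiniteGainLpStabilizing.rescale {σ : ℝ → ℝ} {f : (Fin n → ℝ) → ℝ} {p : ℝ≥0∞} {g : ℝ}
    (hg : 0 < g) (h : IsFiniteGainLpStabilizing n (fun s => -g * -σ (-s)) f p) :
    IsFiniteGainLpStabilizing n σ (fun x => -f (g • x)) p := by
  obtain ⟨γ, hγ, hgain⟩ := h
  refine ⟨g⁻¹ * γ, by positivity, fun d hd => ?_⟩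
  obtain ⟨h1, h2⟩ := hgain (-d) hd.neg
  have htraj : ∀ (T : ℝ≥0∞) (x : ℝ → Fin n → ℝ),
      IsTrajectory n σ (fun x => -f (g • x)) d T x →
      IsTrajectory n (fun s => -g * -σ (-s)) f (-d) T fun t => g • x t := by
    intro T x hT
    refine ⟨fun t ht => (hT.1 t ht).const_smul g, ?_⟩
    filter_upwards [hT.2] with t ht
    refine (ht.const_smul g).congr_deriv ?_
    rw [smul_add, smul_smul, Matrix.mulVec_smul, Pi.neg_apply, neg_add, neg_neg]
    congr 2
    ring
  have hnorm : ∀ x : Fin n → ℝ, WithLp.toLp 2 x = g⁻¹ • WithLp.toLp 2 (g • x) := fun x => by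
    rw [WithLp.toLp_smul, smul_smul, inv_mul_cancel₀ hg.ne', one_smul]
  have hinv : ‖g⁻¹‖ₑ = ENNReal.ofReal g⁻¹ := Real.enorm_eq_ofReal (by positivity)
  rw [eLpNorm_neg] at h1 h2
  refine ⟨fun T x hT hx0 => ?_, fun hp x hT => ?_⟩
  · have h3 := h1 T _ (htraj T x hT) (by simp [hx0])
    simp_rw [hnorm (x _)]
    refine (eLpNorm_const_smul g⁻¹ (fun t => WithLp.toLp 2 (g • x t)) p _).trans_le ?_
    rw [hinv, ENNReal.ofReal_mul (by positivity), mul_assoc]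
    gcongr
  · have h3 := h2 hp _ (htraj ∞ x hT)
    simp_rw [hnorm (x _), enorm_smul]
    rw [ENNReal.limsup_const_mul_of_ne_top (by simp), hinv, ENNReal.ofReal_mul (by positivity),
      mul_assoc]
    gcongr

end Rescale

end IntegratorChain

theorem theorem2 (n : ℕ) (hn : 2 ≤ n) :
    -- admissible gains exist
    (∃ l : ℕ → ℝ, IntegratorChain.AdmissibleGains n l) ∧
    ∀ l : ℕ → ℝ, IntegratorChain.AdmissibleGains n l →
    ∀ (σ : ℝ → ℝ) (a₁ a₂ b₁ b₂ σinf : ℝ), IntegratorChain.IsSFunction σ a₁ a₂ b₁ b₂ σinf →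
      -- the linear feedback exists
      (∃ (K : Fin n → ℝ) (P : Matrix (Fin n) (Fin n) ℝ),
        IntegratorChain.RobustLyapunovPair n (l n / σinf) (a₁ / b₁) (a₂ / b₂) K P) ∧
      ∀ (K : Fin n → ℝ) (P : Matrix (Fin n) (Fin n) ℝ),
        IntegratorChain.RobustLyapunovPair n (l n / σinf) (a₁ / b₁) (a₂ / b₂) K P →
      ∀ A : ℝ, 0 < A →
        (∀ x : Fin n → ℝ, IntegratorChain.quadNorm P x ≤ A → |K ⬝ᵥ x| ≤ min 1 (min b₁ b₂)) →
      ∃ k₀ : ℝ, 0 < k₀ ∧ ∀ k : ℝ, k₀ ≤ k → ∀ p : ENNReal, 1 ≤ p →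
        -- `ẋ = J_n x - (l_n / σ_{+∞}) e_n σ(u)` with `u = k ω(x)`
        IntegratorChain.IsFiniteGainLpStabilizing n (fun s => -(l n / σinf) * σ s)
          (fun x => k * IntegratorChain.switchedFeedback l K P A k x) p ∧
        -- `ẋ = J_n x + e_n σ(u)` with `u = -k ω((l_n / σ_{+∞}) x)`
        IntegratorChain.IsFiniteGainLpStabilizing n σ
          (fun x => -(k * IntegratorChain.switchedFeedback l K P A k ((l n / σinf) • x))) p := by
  refine ⟨IntegratorChain.exists_admissibleGains hn, fun l hl σ a₁ a₂ b₁ b₂ σinf hS => ?_⟩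
  have hσ := hS.isSaturation
  have hg : 0 < l n / σinf := div_pos (hl.1 n (by omega) le_rfl) hσ.limit_pos
  refine ⟨IntegratorChain.exists_robustLyapunovPair hg (div_pos hσ.a₁_pos hσ.b₁_pos) _,
    fun K P hKP A hA hKA => ?_⟩
  obtain ⟨k₁, hk₁, h₁⟩ :=
    IntegratorChain.exists_isFiniteGainLpStabilizing_switchedFeedback hn hl hσ hKP hA hKA
  obtain ⟨k₂, hk₂, h₂⟩ :=
    IntegratorChain.exists_isFiniteGainLpStabilizing_switchedFeedback hn hl hσ.reflect hKP hA hKA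
  refine ⟨max k₁ k₂, lt_max_of_lt_left hk₁, fun k hk p hp =>
    ⟨h₁ k ((le_max_left _ _).trans hk) p hp, ?_⟩⟩
  exact IntegratorChain.IsFiniteGainLpStabilizing.rescale
    (f := fun x => k * IntegratorChain.switchedFeedback l K P A k x) hg
    (h₂ k ((le_max_right _ _).trans hk) p hp)
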